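/- **Setting.** Consider $\min\{f(z)+h(z) : Az=b,\ z\in\mathbb R^n\}$ with $b\in\mathbb R^l$, where * (C1) $h:\mathbb R^n\to(-\infty,+\infty]$ is proper, lower semicontinuous and convex, $A:\mathbb R^n\to\mathbb R^l$ is linear, $A\neq 0$, and $\mathcal F:=\{z\in\operatorname{dom}h : Az=b\}\ne\emptyset$; * (C2) $f:\mathbb R^n\to\mathbb R$ is differentiable at every point of $\operatorname{dom}h$, and there are scalars $0<m_f\le L_f$ such that for all $u,z\in\operatorname{dom}h$: $\|\nabla f(z)-\nabla f(u)\|\le L_f\|z-u\|$ and $f(z)+\langle\nabla f(z),u-z\rangle-\frac{m_f}{2}\|u-z\|^2\le f(u)$; * (C3) $\hat c\ge 0$ is such that $\hat\varphi_{\hat c}>-\infty$, where $\varphi_c(z):=f(z)+h(z)+\frac c2\|Az-b\|^2$ and $\hat\varphi_c:=\inf_z\varphi_c(z)$. Let $z_0\in\operatorname{dom}h$, $\sigma\in(0,1)$ and tolerances $\hat\rho,\hat\eta>0$. All norms are Euclidean and $\|A\|$ is the operator norm. $\partial_\varepsilon\psi(z)=\{v:\psi(u)\ge\psi(z)+\langle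 v,u-z\rangle-\varepsilon\ \forall u\}$ for $z\in\operatorname{dom}\psi$, $\partial=\partial_0$, $\ell_\psi(u;z)=\psi(z)+\langle\nabla\psi(z),u-z\rangle$ and $\log_1^+t=\max\{\log t,1\}$. **ACG method** for $\psi_s+\psi_n$ with constants $\mu,L$, started from $x_0$. Put $y_0=x_0$, $A_0=0$, $\Gamma_0\equiv0$. Iteration $j+1$ computes $A_{j+1}=A_j+\frac{\mu A_j+1+\sqrt{(\mu A_j+1)^2+4L(\mu A_j+1)A_j}}{2L}$, $\tilde x_j=\frac{A_j}{A_{j+1}}x_j+\frac{A_{j+1}-A_j}{A_{j+1}}y_j$, $\Gamma_{j+1}=\frac{A_j}{A_{j+1}}\Gamma_j+\frac{A_{j+1}-A_j}{A_{j+1}}\ell_{\psi_s}(\cdot;\tilde x_j)$, $y_{j+1}=\operatorname{argmin}_y\{\Gamma_{j+1}(y)+\psi_n(y)+\frac1{2A_{j+1}}\|y-y_0\|^2\}$, $x_{j+1}=\frac{A_j}{A_{j+1}}x_j+\frac{A_{j+1}-A_j}{A_{j+1}}y_{j+1}$, and also $u_{j+1}=(y_0-y_{j+1})/A_{j+1}$,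 $\eta_{j+1}=(\psi_s+\psi_n)(x_{j+1})-\Gamma_{j+1}(y_{j+1})-\psi_n(y_{j+1})-\langle u_{j+1},x_{j+1}-y_{j+1}\rangle$. **AIPP method** for $g+h$ with inputs $z_0,\sigma,M,\lambda,\bar\rho,\bar\varepsilon$. In outer iteration $k=1,2,\dots$, run the ACG method from $z_{k-1}$ with $\psi_s=\lambda g+\frac14\|\cdot-z_{k-1}\|^2$, $\psi_n=\lambda h+\frac14\|\cdot-z_{k-1}\|^2$, $\mu=\frac12$, $L=\lambda M+\frac12$, up to the first iteration $j\ge\lceil6\sqrt{2\lambda M+1}\rceil$ whose triple $(x,u,\eta)=(x_j,u_j,\eta_j)$ satisfies $$\eta\ge0,\quad u\in\partial_\eta\big(\lambda(g+h)+\tfrac12\|\cdot-z_{k-1}\|^2\big)(x),\quad \|u\|^2+2\eta\le\sigma\|z_{k-1}-x+u\|^2.\qquad(*)$$ If $\|z_{k-1}-x+u\|>\lambda\bar\rho/5$, set $z_k=x$ and go to the next outer iteration. Otherwise continue the same ACG run up to the first iteration $j'\ge j$ whose triple $(\tilde x,\tilde u,\tilde\eta)$ satisfies $(*)$ and $\tilde\eta/\lambda\le\bar\varepsilon$,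 and output $(z^-,z,w,\varepsilon)=(z_{k-1},\tilde x,\tilde u/\lambda,\tilde\eta/\lambda)$. **QP-AIPP method.** Put $\lambda=\frac1{2m_f}$ and $c=\hat c+L_f/\|A\|^2$. Loop: 1. With $g=g_c:=f+\frac c2\|A\cdot-b\|^2$ and $M=L_f+c\|A\|^2$, apply the AIPP method from $z_0$ with $\sigma$, $M$, $\lambda$ and $(\bar\rho,\bar\varepsilon)=\big(\frac{\hat\rho}4,\frac{\hat\rho^2}{32(M+2m_f)}\big)$, and let $z$ be the second component of its output. 2. Compute $z_g=\operatorname{argmin}_u\{\ell_g(u;z)+h(u)+\frac{M+\lambda^{-1}}2\|u-z\|^2\}$ and $v_g=(M+\lambda^{-1})(z-z_g)+\nabla g(z_g)-\nabla g(z)$. 3. If $\|Az_g-b\|>\hat\eta$, replace $c$ by $2c$ and repeat; otherwise stop and output $(\hat z,\hat v,\hat p)=(z_g,v_g,c(Az_g-b))$. The *inner iterations* are all ACG iterations performed in all calls of the ACG method. **Theorem (QP-AIPP complexity).** Put $$R_{\hat c}(\lambda)=\inf_{u\in\mathcal F}\Big\{\tfrac12\|z_0-u\|^2+(1-\sigma)\lambda[\varphi_{\hat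 c}(u)-\hat\varphi_{\hat c}]\Big\},\quad T_{\hat\eta}=\frac{2R_{\hat c}(\lambda)}{\hat\eta^2(1-\sigma)\lambda}+\hat c,\quad \Theta=\frac{L_f+T_{\hat\eta}\|A\|^2}{m_f}.$$ (i) For every $\sigma\in(0,1)$ there is a constant $C=C(\sigma)>0$ such that, for all $n,l$, all data $f,h,A,b,L_f,m_f,\hat c$ satisfying (C1)–(C3), all $z_0\in\operatorname{dom}h$ and all $\hat\rho,\hat\eta>0$, the QP-AIPP method terminates, its output satisfies $$\hat v\in\nabla f(\hat z)+\partial h(\hat z)+A^*\hat p,\qquad\|\hat v\|\le\hat\rho,\qquad\|A\hat z-b\|\le\hat\eta,$$ and its total number of inner iterations is at most $$C\,\sqrt\Theta\left[\frac{m_f^2R_{\hat c}(\lambda)}{\hat\rho^2}+\log_1^+(\Theta)\right].$$ (ii) In terms of the tolerances alone: for fixed $\sigma$, problem data and $z_0$, there is a constant $C'$ such that for all $\hat\rho,\hat\eta\in(0,1]$ the number of inner iterations is at most $C'\,\hat\eta^{-1}\big(\hat\rho^{-2}+\log_1^+(1/\hat\eta)\big)$. Hence it is $O(\hat\rho^{-2}\hat\eta^{-1})$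 as long as the logarithmic term does not dominate: for every $K$ there is a constant $C''$, depending only on $K$, $\sigma$, the problem data and $z_0$, such that it is at most $C''\hat\rho^{-2}\hat\eta^{-1}$ for all $\hat\rho,\hat\eta\in(0,1]$ with $\log(1/\hat\eta)\le K\hat\rho^{-2}$. -/

import Mathlib

noncomputable section

namespace QPAIPP

/-- The Euclidean space of dimension `n`. -/
abbrev Vec (n : ℕ) := EuclideanSpace ℝ (Fin n)

/-- The truncated logarithm `max {log t, 1}`. -/
def logOnePlus (t : ℝ) : ℝ := max (Real.log t) 1

/-- The effective domain of an extended-real-valued function. -/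
def effDom {n : ℕ} (ψ : Vec n → EReal) : Set (Vec n) := {x | ψ x < ⊤}

/-- Proper, lower semicontinuous, convex functions with values in `(-∞, +∞]`. -/
structure IsProperClosedConvex {n : ℕ} (ψ : Vec n → EReal) : Prop where
  ne_bot : ∀ x, ψ x ≠ ⊥
  nonempty_dom : (effDom ψ).Nonempty
  lsc : LowerSemicontinuous ψ
  convex : ∀ x ∈ effDom ψ, ∀ y ∈ effDom ψ, ∀ α ∈ Set.Icc (0 : ℝ) 1,
    ψ (α • x + (1 - α) • y) ≤ (α : EReal) * ψ x + ((1 - α : ℝ) : EReal) * ψ y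

/-- The `ε`-subdifferential of `ψ` at a point `z` of its domain. -/
def epsSubdiff {n : ℕ} (ε : ℝ) (ψ : Vec n → EReal) (z : Vec n) : Set (Vec n) :=
  {v | z ∈ effDom ψ ∧ ∀ u, ψ z + ((inner ℝ v (u - z) - ε : ℝ) : EReal) ≤ ψ u}

/-- The subdifferential of `ψ` at `z`. -/
def subdiff {n : ℕ} (ψ : Vec n → EReal) (z : Vec n) : Set (Vec n) := epsSubdiff 0 ψ z

/-- The affine approximation `z ↦ ψ(w) + ⟨∇ψ(w), z - w⟩` of `ψ` at `w`. -/
def affApprox {n : ℕ} (ψ : Vec n → ℝ) (z w : Vec n) : ℝ :=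
  ψ w + inner ℝ (gradient ψ w) (z - w)

/-- A global minimizer of `F`. It is only used for proper closed strongly convex functions,
which have exactly one. -/
def argmin {n : ℕ} (F : Vec n → EReal) : Vec n :=
  Classical.epsilon fun y => ∀ y', F y ≤ F y'

/-! ### The accelerated composite gradient (ACG) method -/

/-- The quantities `(A_j, Γ_j, x_j, y_j)` carried from one ACG iteration to the next. -/
structure ACGState (n : ℕ) where
  A : ℝ
  Γ : Vec n → ℝ
  x : Vec n
  y : Vec n

/-- The input of the ACG method for minimizing `ψs + ψn`, where `ψn` is `μ`-strongly convex and
`ψs` has upper curvature `L`, started from `x0`. -/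
structure ACGInput (n : ℕ) where
  ψs : Vec n → ℝ
  ψn : Vec n → EReal
  μ : ℝ
  L : ℝ
  x0 : Vec n

/-- One iteration of the ACG method. -/
def ACGInput.step {n : ℕ} (I : ACGInput n) (s : ACGState n) : ACGState n :=
  let A' : ℝ := s.A + (I.μ * s.A + 1 +
    Real.sqrt ((I.μ * s.A + 1) ^ 2 + 4 * I.L * (I.μ * s.A + 1) * s.A)) / (2 * I.L)
  let xt : Vec n := (s.A / A') • s.x + ((A' - s.A) / A') • s.y
  let Γ' : Vec n → ℝ := fun z => s.A / A' * s.Γ z + (A' - s.A) / A' * affApprox I.ψs z xt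
  let y' : Vec n := argmin fun y =>
    ((Γ' y : ℝ) : EReal) + I.ψn y + ((1 / (2 * A') * ‖y - I.x0‖ ^ 2 : ℝ) : EReal)
  { A := A'
    Γ := Γ'
    x := (s.A / A') • s.x + ((A' - s.A) / A') • y'
    y := y' }

/-- The state of the ACG method after `j` iterations. -/
def ACGInput.iter {n : ℕ} (I : ACGInput n) : ℕ → ACGState n
  | 0 => { A := 0, Γ := fun _ => 0, x := I.x0, y := I.x0 }
  | j + 1 => I.step (I.iter j)

/-- The iterate `x_j`. -/
def ACGInput.x {n : ℕ} (I : ACGInput n) (j : ℕ) : Vec n := (I.iter j).x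

/-- The residual `u_j = (y_0 - y_j) / A_j`. -/
def ACGInput.u {n : ℕ} (I : ACGInput n) (j : ℕ) : Vec n :=
  (1 / (I.iter j).A) • (I.x0 - (I.iter j).y)

/-- The residual `η_j = (ψs + ψn)(x_j) - Γ_j(y_j) - ψn(y_j) - ⟨u_j, x_j - y_j⟩`. -/
def ACGInput.η {n : ℕ} (I : ACGInput n) (j : ℕ) : ℝ :=
  (I.ψs (I.iter j).x + (I.ψn (I.iter j).x).toReal) - (I.iter j).Γ (I.iter j).y
    - (I.ψn (I.iter j).y).toReal - inner ℝ (I.u j) ((I.iter j).x - (I.iter j).y)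

/-! ### The accelerated inexact proximal point (AIPP) method -/

/-- The input of the AIPP method for minimizing `g + h`, except for its initial point:
`M` is the upper curvature of `g`, `lam` the prox stepsize, `(ρ, ε)` the tolerance pair. -/
structure AIPPInput (n : ℕ) where
  g : Vec n → ℝ
  h : Vec n → EReal
  M : ℝ
  σ : ℝ
  lam : ℝ
  ρ : ℝ
  ε : ℝ

/-- The ACG call made by the AIPP method with prox center `z`:
`ψs = λ g + ‖· - z‖² / 4`, `ψn = λ h + ‖· - z‖² / 4`, `μ = 1 / 2`, `L = λ M + 1 / 2`. -/
def AIPPInput.acg {n : ℕ} (I : AIPPInput n) (z : Vec n) : ACGInput n where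
  ψs := fun x => I.lam * I.g x + 1 / 4 * ‖x - z‖ ^ 2
  ψn := fun x => (I.lam : EReal) * I.h x + ((1 / 4 * ‖x - z‖ ^ 2 : ℝ) : EReal)
  μ := 1 / 2
  L := I.lam * I.M + 1 / 2
  x0 := z

/-- The triple `(x, u, η)` is a `σ`-approximate solution of the prox subproblem with center `z`:
`η ≥ 0`, `u ∈ ∂_η (λ (g + h) + ‖· - z‖² / 2) (x)` and `‖u‖² + 2 η ≤ σ ‖z - x + u‖²`. -/
def AIPPInput.IsProxApprox {n : ℕ} (I : AIPPInput n) (z x u : Vec n) (η : ℝ) : Prop :=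
  0 ≤ η ∧
  u ∈ epsSubdiff η (fun w => (I.lam : EReal) * ((I.g w : EReal) + I.h w)
    + ((1 / 2 * ‖w - z‖ ^ 2 : ℝ) : EReal)) x ∧
  ‖u‖ ^ 2 + 2 * η ≤ I.σ * ‖z - x + u‖ ^ 2

/-- `j` is the number of ACG iterations made in step 1 of the AIPP method with prox center `z`:
the first `j ≥ ⌈6 √(2 λ M + 1)⌉` at which the ACG iterate is a `σ`-approximate solution. -/
def AIPPInput.IsStepOne {n : ℕ} (I : AIPPInput n) (z : Vec n) (j : ℕ) : Prop :=
  IsLeast {i : ℕ | ⌈6 * Real.sqrt (2 * I.lam * I.M + 1)⌉₊ ≤ i ∧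
    I.IsProxApprox z ((I.acg z).x i) ((I.acg z).u i) ((I.acg z).η i)} j

/-- When step 1 ended at ACG iteration `j`, the same ACG call is continued in step 3 up to its
`j'`-th iteration, the first one that is a `σ`-approximate solution with `η / λ ≤ ε`. -/
def AIPPInput.IsStepThree {n : ℕ} (I : AIPPInput n) (z : Vec n) (j j' : ℕ) : Prop :=
  IsLeast {i : ℕ | j ≤ i ∧
    I.IsProxApprox z ((I.acg z).x i) ((I.acg z).u i) ((I.acg z).η i) ∧
    (I.acg z).η i / I.lam ≤ I.ε} j'

/-- The output `(z⁻, z, w, ε)` of the AIPP method. -/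
structure AIPPOutput (n : ℕ) where
  zprev : Vec n
  z : Vec n
  w : Vec n
  ε : ℝ

/-- `I.Run z out N`: the AIPP method started from `z` terminates with output `out` after a total
of `N` ACG iterations. The method is deterministic: it has at most one run from `z`, and one exactly
if it terminates. -/
inductive AIPPInput.Run {n : ℕ} (I : AIPPInput n) : Vec n → AIPPOutput n → ℕ → Prop
  | last (z : Vec n) (j j' : ℕ) (h1 : I.IsStepOne z j)
      (h2 : ‖z - (I.acg z).x j + (I.acg z).u j‖ ≤ I.lam * I.ρ / 5)
      (h3 : I.IsStepThree z j j') :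
      AIPPInput.Run I z
        { zprev := z
          z := (I.acg z).x j'
          w := (1 / I.lam) • (I.acg z).u j'
          ε := (I.acg z).η j' / I.lam } j'
  | next (z : Vec n) (j : ℕ) (out : AIPPOutput n) (N : ℕ) (h1 : I.IsStepOne z j)
      (h2 : I.lam * I.ρ / 5 < ‖z - (I.acg z).x j + (I.acg z).u j‖)
      (h3 : AIPPInput.Run I ((I.acg z).x j) out N) :
      AIPPInput.Run I z out (j + N)

/-- The composite gradient step from `z` with curvature constant `M + λ⁻¹`. -/
def AIPPInput.zg {n : ℕ} (I : AIPPInput n) (z : Vec n) : Vec n :=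
  argmin fun u => (affApprox I.g u z : EReal) + I.h u
    + (((I.M + I.lam⁻¹) / 2 * ‖u - z‖ ^ 2 : ℝ) : EReal)

/-- The vector `v_g = (M + λ⁻¹) (z - z_g) + ∇g(z_g) - ∇g(z)`. -/
def AIPPInput.vg {n : ℕ} (I : AIPPInput n) (z : Vec n) : Vec n :=
  (I.M + I.lam⁻¹) • (z - I.zg z) + gradient I.g (I.zg z) - gradient I.g z

/-! ### The linearly constrained problem and the QP-AIPP method -/

/-- The data of the problem `min {f(z) + h(z) : A z = b}`, with the curvature constants `Lf`, `mf`
of `f` and the penalty parameter `chat`. -/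
structure Problem (n l : ℕ) where
  f : Vec n → ℝ
  h : Vec n → EReal
  A : Vec n →L[ℝ] Vec l
  b : Vec l
  Lf : ℝ
  mf : ℝ
  chat : ℝ

/-- The feasible set `{z ∈ dom h : A z = b}`. -/
def Problem.feasible {n l : ℕ} (P : Problem n l) : Set (Vec n) :=
  {z | z ∈ effDom P.h ∧ P.A z = P.b}

/-- The smooth part `g_c = f + (c / 2) ‖A · - b‖²` of the penalized objective. -/
def Problem.g {n l : ℕ} (P : Problem n l) (c : ℝ) (z : Vec n) : ℝ :=
  P.f z + c / 2 * ‖P.A z - P.b‖ ^ 2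

/-- The penalized objective `φ_c = f + h + (c / 2) ‖A · - b‖²`. -/
def Problem.φ {n l : ℕ} (P : Problem n l) (c : ℝ) (z : Vec n) : EReal :=
  (P.f z : EReal) + P.h z + ((c / 2 * ‖P.A z - P.b‖ ^ 2 : ℝ) : EReal)

/-- The optimal value of the penalized problem. -/
def Problem.φstar {n l : ℕ} (P : Problem n l) (c : ℝ) : EReal := ⨅ z, P.φ c z

/-- The standing assumptions (C1), (C2), (C3). -/
structure Problem.Assumptions {n l : ℕ} (P : Problem n l) : Prop where
  h_conv : IsProperClosedConvex P.h
  A_ne_zero : P.A ≠ 0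
  feasible_nonempty : P.feasible.Nonempty
  f_diff : ∀ z ∈ effDom P.h, DifferentiableAt ℝ P.f z
  mf_pos : 0 < P.mf
  mf_le_Lf : P.mf ≤ P.Lf
  f_lip : ∀ u ∈ effDom P.h, ∀ z ∈ effDom P.h,
    ‖gradient P.f z - gradient P.f u‖ ≤ P.Lf * ‖z - u‖
  f_lower : ∀ u ∈ effDom P.h, ∀ z ∈ effDom P.h,
    -P.mf / 2 * ‖u - z‖ ^ 2 + affApprox P.f u z ≤ P.f u
  chat_nonneg : 0 ≤ P.chat
  bdd_below : ⊥ < P.φstar P.chat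

/-- `R_c(λ) = inf {‖z0 - u‖² / 2 + (1 - σ) λ [φ_c(u) - inf φ_c] : u feasible}`. Under the standing
assumptions and for `c ≥ chat`, both `φ_c(u)` and `inf φ_c` are finite here. -/
def Problem.R {n l : ℕ} (P : Problem n l) (σ : ℝ) (z0 : Vec n) (c lam : ℝ) : ℝ :=
  ⨅ u : P.feasible, (1 / 2 * ‖z0 - u‖ ^ 2
    + (1 - σ) * lam * ((P.φ c u).toReal - (P.φstar c).toReal))

/-- The prox stepsize `λ = 1 / (2 m_f)`. -/
def Problem.lam {n l : ℕ} (P : Problem n l) : ℝ := 1 / (2 * P.mf)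

/-- The threshold `T = 2 R_chat(λ) / (η² (1 - σ) λ) + chat` on the penalty parameter. -/
def Problem.T {n l : ℕ} (P : Problem n l) (σ : ℝ) (z0 : Vec n) (η : ℝ) : ℝ :=
  2 * P.R σ z0 P.chat P.lam / (η ^ 2 * (1 - σ) * P.lam) + P.chat

/-- The ratio `Θ = (L_f + T ‖A‖²) / m_f`. -/
def Problem.Θ {n l : ℕ} (P : Problem n l) (σ : ℝ) (z0 : Vec n) (η : ℝ) : ℝ :=
  (P.Lf + P.T σ z0 η * ‖P.A‖ ^ 2) / P.mf

/-- The AIPP call of the QP-AIPP method with penalty parameter `c`: it is applied to `g_c + h` with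
`M = L_f + c ‖A‖²`, `λ = 1 / (2 m_f)` and the tolerances `ρ / 4`, `ρ² / (32 (M + 2 m_f))`. -/
def Problem.aipp {n l : ℕ} (P : Problem n l) (σ ρ c : ℝ) : AIPPInput n where
  g := P.g c
  h := P.h
  M := P.Lf + c * ‖P.A‖ ^ 2
  σ := σ
  lam := P.lam
  ρ := ρ / 4
  ε := ρ ^ 2 / (32 * (P.Lf + c * ‖P.A‖ ^ 2 + 2 * P.mf))

/-- The output `(ẑ, v̂, p̂)` of the QP-AIPP method. -/
structure Output (n l : ℕ) where
  z : Vec n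
  v : Vec n
  p : Vec l

/-- `P.RunFrom σ ρ η z0 c out N`: the loops of the QP-AIPP method, entered with penalty
parameter `c`, terminate with output `out` after a total of `N` ACG iterations. -/
inductive Problem.RunFrom {n l : ℕ} (P : Problem n l) (σ ρ η : ℝ) (z0 : Vec n) :
    ℝ → Output n l → ℕ → Prop
  | last (c : ℝ) (o : AIPPOutput n) (N : ℕ) (h1 : (P.aipp σ ρ c).Run z0 o N)
      (h2 : ‖P.A ((P.aipp σ ρ c).zg o.z) - P.b‖ ≤ η) :
      Problem.RunFrom P σ ρ η z0 c
        { z := (P.aipp σ ρ c).zg o.z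
          v := (P.aipp σ ρ c).vg o.z
          p := c • (P.A ((P.aipp σ ρ c).zg o.z) - P.b) } N
  | next (c : ℝ) (o : AIPPOutput n) (N : ℕ) (out : Output n l) (N' : ℕ)
      (h1 : (P.aipp σ ρ c).Run z0 o N)
      (h2 : η < ‖P.A ((P.aipp σ ρ c).zg o.z) - P.b‖)
      (h3 : Problem.RunFrom P σ ρ η z0 (2 * c) out N') :
      Problem.RunFrom P σ ρ η z0 c out (N + N')

/-- `P.Run σ ρ η z0 out N`: the QP-AIPP method with parameter `σ` and tolerances `(ρ, η)`, started
from `z0`, terminates with output `out` after a total of `N` ACG iterations. Its first penalty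
parameter is `chat + L_f / ‖A‖²`. -/
def Problem.Run {n l : ℕ} (P : Problem n l) (σ ρ η : ℝ) (z0 : Vec n) (out : Output n l) (N : ℕ) :
    Prop :=
  P.RunFrom σ ρ η z0 (P.chat + P.Lf / ‖P.A‖ ^ 2) out N

/-- `(ρ, η)`-approximate solutions: `v ∈ ∇f(z) + ∂h(z) + A* p`, `‖v‖ ≤ ρ`, `‖A z - b‖ ≤ η`. -/
def Problem.IsApproxSolution {n l : ℕ} (P : Problem n l) (ρ η : ℝ) (out : Output n l) : Prop :=
  (∃ s ∈ subdiff P.h out.z,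
    out.v = gradient P.f out.z + s + ContinuousLinearMap.adjoint P.A out.p) ∧
  ‖out.v‖ ≤ ρ ∧ ‖P.A out.z - P.b‖ ≤ η

end QPAIPP

end

/-!
For the ACG method, `A_j (ψs + ψn)(x_j)` stays below the minimum of the model
`A_j (Γ_j + ψn) + ‖· - x_0‖² / 2`, whose modulus of strong convexity is `1 + μ A_j`. The recursion
for `A_j` makes it grow both like `j² / (4 L)` and geometrically. Once `μ A_j ≥ 9`, this forces
`‖u_j‖² + 2 η_j` to be at most `18 / A_j` times `‖x_0 - x_j + u_j‖²`, so that `O(√(λ M + 1))`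
iterations yield a `σ`-approximate solution of a prox subproblem; the geometric growth makes `η_j`
small at the cost of a logarithmic factor.

An outer iteration of the AIPP method which is not the last decreases `λ (g + h)` by at least
`(1 - σ) / 2 * (λ ρ̄ / 5)²`. Comparing the first outer iterate with a feasible point, whose
objective does not see the penalty, bounds `λ` times its gap by `R / (1 - σ)` uniformly in `c`; this
bounds the number of outer iterations. The same gap bound shows that a call whose output violates
`‖A z - b‖ ≤ η` has `c ≤ T`, so the penalty parameter never exceeds `2 T` or its initial value,
and since it doubles, the costs of the calls, proportional to `√c`, sum up to a multiple of the last
one.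
-/

namespace QPAIPP

open scoped RealInnerProductSpace

/-! ### Strong convexity and the descent lemma -/

section NormedSpace

variable {E : Type*} [NormedAddCommGroup E] [NormedSpace ℝ E] {s : Set E} {f g : E → ℝ} {μ τ : ℝ}

theorem strongConvexOn_add (hf : StrongConvexOn s μ f) (hg : StrongConvexOn s τ g) :
    StrongConvexOn s (μ + τ) fun x => f x + g x := by
  refine ⟨hf.1, fun x hx y hy a b ha hb hab => ?_⟩
  have hfg := (UniformConvexOn.add hf hg).2 hx hy ha hb hab
  simp only [Pi.add_apply] at hfg
  exact hfg.trans_eq (by ring)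

theorem strongConvexOn_congr (hf : StrongConvexOn s μ f) (hfg : Set.EqOn f g s) :
    StrongConvexOn s μ g :=
  ⟨hf.1, fun x hx y hy a b ha hb hab => by
    rw [← hfg hx, ← hfg hy, ← hfg (hf.1 hx hy ha hb hab)]
    exact hf.2 hx hy ha hb hab⟩

theorem add_sq_norm_le_of_strongConvexOn (hf : StrongConvexOn s μ f) {p : E} (hp : p ∈ s)
    (hmin : IsMinOn f s p) {x : E} (hx : x ∈ s) : f p + μ / 2 * ‖x - p‖ ^ 2 ≤ f x := by
  have growth_segment : ∀ t ∈ Set.Ioo (0 : ℝ) 1, (1 - t) * (μ / 2 * ‖x - p‖ ^ 2) ≤ f x - f p := by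
    intro t ht
    have h1t : 0 ≤ 1 - t := sub_nonneg.2 ht.2.le
    have hle := (isMinOn_iff.1 hmin _ (hf.1 hx hp ht.1.le h1t (add_sub_cancel t 1))).trans
      (hf.2 hx hp ht.1.le h1t (add_sub_cancel t 1))
    simp only [smul_eq_mul] at hle
    refine le_of_mul_le_mul_left ?_ ht.1
    linear_combination hle
  have hlim : Filter.Tendsto (fun t : ℝ => (1 - t) * (μ / 2 * ‖x - p‖ ^ 2))
      (nhdsWithin 0 (Set.Ioi 0)) (nhds ((1 - 0) * (μ / 2 * ‖x - p‖ ^ 2))) :=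
    (Continuous.tendsto (by fun_prop) 0).mono_left nhdsWithin_le_nhds
  have := le_of_tendsto hlim
    (Filter.eventually_of_mem (Ioo_mem_nhdsGT (zero_lt_one' ℝ)) growth_segment)
  linarith only [this]

theorem norm_sub_le_of_strongConvexOn (hf : StrongConvexOn s μ f) (hμ : 0 < μ) {p x : E}
    (hp : p ∈ s) (hx : x ∈ s) (hxp : f x ≤ f p) {c : ℝ}
    (hc : ∀ y ∈ s, ‖y - p‖ ≤ 1 → c ≤ f y) : ‖x - p‖ ≤ 1 + 2 * (f p - c) / μ := by
  have hcp : c ≤ f p := hc p hp (by simp)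
  rcases le_or_gt ‖x - p‖ 1 with hle | hgt
  · exact hle.trans (le_add_of_nonneg_right
      (div_nonneg (mul_nonneg zero_le_two (sub_nonneg.2 hcp)) hμ.le))
  set t := ‖x - p‖ with ht
  have ht0 : 0 < t := one_pos.trans hgt
  have hinv0 : 0 ≤ t⁻¹ := inv_nonneg.2 ht0.le
  have hinv1 : 0 ≤ 1 - t⁻¹ := sub_nonneg.2 (inv_le_one_of_one_le₀ hgt.le)
  have hball : ‖t⁻¹ • x + (1 - t⁻¹) • p - p‖ ≤ 1 := by
    rw [show t⁻¹ • x + (1 - t⁻¹) • p - p = t⁻¹ • (x - p) by module, norm_smul,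
      Real.norm_of_nonneg hinv0, ← ht, inv_mul_cancel₀ ht0.ne']
  have hlow := (hc _ (hf.1 hx hp hinv0 hinv1 (add_sub_cancel _ _)) hball).trans
    (hf.2 hx hp hinv0 hinv1 (add_sub_cancel _ _))
  simp only [smul_eq_mul, ← ht] at hlow
  have hquad : t⁻¹ * (1 - t⁻¹) * (μ / 2 * t ^ 2) = μ / 2 * (t - 1) := by field_simp
  have : t⁻¹ * f x ≤ t⁻¹ * f p := mul_le_mul_of_nonneg_left hxp hinv0
  rw [← sub_le_iff_le_add', le_div_iff₀ hμ]
  linarith only [hlow, hquad, this]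

end NormedSpace

section InnerProductSpace

variable {E : Type*} [NormedAddCommGroup E] [InnerProductSpace ℝ E]

theorem norm_sub_sq_eq_add_inner (u y y' : E) :
    ‖u - y‖ ^ 2 = ‖y' - y‖ ^ 2 + ‖u - y'‖ ^ 2 + 2 * ⟪y' - y, u - y'⟫ := by
  rw [show u - y = (y' - y) + (u - y') by abel, norm_add_sq_real]
  ring

theorem strongConvexOn_half_mul_norm_sub_sq {s : Set E} (hs : Convex ℝ s) (τ : ℝ) (z : E) :
    StrongConvexOn s τ fun x => τ / 2 * ‖x - z‖ ^ 2 := by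
  refine strongConvexOn_iff_convex.2 ?_
  have hlin : (fun x => τ / 2 * ‖x - z‖ ^ 2 - τ / 2 * ‖x‖ ^ 2)
      = fun x => (-τ • innerₛₗ ℝ z) x + τ / 2 * ‖z‖ ^ 2 := by
    funext x
    simp only [norm_sub_sq_real, real_inner_comm, LinearMap.smul_apply, innerₛₗ_apply_apply,
      smul_eq_mul]
    ring
  rw [hlin]
  exact (LinearMap.convexOn _ hs).add_const _

variable [CompleteSpace E] {f : E → ℝ}

theorem le_add_inner_gradient_add_of_lipschitz {s : Set E} (hs : Convex ℝ s)
    (hf : ∀ z ∈ s, DifferentiableAt ℝ f z) {z : E} {L : ℝ}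
    (hL : ∀ w ∈ s, ‖gradient f w - gradient f z‖ ≤ L * ‖w - z‖) {u : E} (hz : z ∈ s)
    (hu : u ∈ s) : f u ≤ f z + ⟪gradient f z, u - z⟫ + L / 2 * ‖u - z‖ ^ 2 := by
  let w : ℝ → E := fun t => z + t • (u - z)
  let gap : ℝ → ℝ := fun t => f (w t) - t * ⟪gradient f z, u - z⟫ - L / 2 * t ^ 2 * ‖u - z‖ ^ 2
  have hw : ∀ t ∈ Set.Icc (0 : ℝ) 1, w t ∈ s := fun t ht => hs.add_smul_sub_mem hz hu ht
  have hder : ∀ t ∈ Set.Icc (0 : ℝ) 1, HasDerivAt gap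
      (⟪gradient f (w t), u - z⟫ - ⟪gradient f z, u - z⟫ - L * t * ‖u - z‖ ^ 2) t := by
    intro t ht
    have hline : HasDerivAt w (u - z) t := by
      simpa only [id, one_smul] using! ((hasDerivAt_id t).smul_const (u - z)).const_add z
    have hfw := (hf _ (hw t ht)).hasGradientAt.hasFDerivAt.comp_hasDerivAt t hline
    have hlin := (hasDerivAt_id t).mul_const ⟪gradient f z, u - z⟫
    have hsq := (((hasDerivAt_id t).pow 2).const_mul (L / 2)).mul_const (‖u - z‖ ^ 2)
    convert! (hfw.sub hlin).sub hsq using 1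
    simp only [id, InnerProductSpace.toDual_apply_apply]
    push_cast
    ring
  have hanti : AntitoneOn gap (Set.Icc 0 1) := by
    refine antitoneOn_of_deriv_nonpos (convex_Icc 0 1)
      (fun t ht => (hder t ht).continuousAt.continuousWithinAt)
      (fun t ht => (hder t (interior_subset ht)).differentiableAt.differentiableWithinAt)
      fun t ht => ?_
    have ht' := interior_subset ht
    rw [(hder t ht').deriv, ← inner_sub_left]
    have hlip : ‖gradient f (w t) - gradient f z‖ ≤ L * (t * ‖u - z‖) := by
      simpa [w, norm_smul, abs_of_nonneg ht'.1] using hL _ (hw t ht')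
    have := (real_inner_le_norm _ (u - z)).trans
      (mul_le_mul_of_nonneg_right hlip (norm_nonneg (u - z)))
    linarith only [this]
  have := hanti (Set.left_mem_Icc.2 zero_le_one) (Set.right_mem_Icc.2 zero_le_one) zero_le_one
  simp only [gap, w, one_smul, zero_smul, add_zero, add_sub_cancel] at this
  linarith only [this]

theorem hasGradientAt_mul_add_sq {f' x : E} (hf : HasGradientAt f f' x) (a κ : ℝ) (z : E) :
    HasGradientAt (fun w => a * f w + κ * ‖w - z‖ ^ 2) (a • f' + (2 * κ) • (x - z)) x := by
  have hsq := (((hasStrictFDerivAt_norm_sq (x - z)).hasFDerivAt.comp x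
    ((hasFDerivAt_id x).sub_const z)).const_mul κ)
  have hsum := (hf.hasFDerivAt.const_mul a).add hsq
  rw [hasGradientAt_iff_hasFDerivAt]
  refine hsum.congr_fderiv ?_
  ext v
  simp only [map_sub, ContinuousLinearMap.comp_id, add_apply, smul_apply,
    InnerProductSpace.toDual_apply_apply, smul_eq_mul, sub_apply, coe_innerSL_apply, nsmul_eq_mul,
    Nat.cast_ofNat, map_add, map_smul, add_right_inj]
  ring

end InnerProductSpace

/-! ### Extended-real-valued convex functions -/

section ExtendedReal

variable {n : ℕ} {ψ : Vec n → EReal}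

theorem eq_top_of_notMem_effDom {x : Vec n} (hx : x ∉ effDom ψ) : ψ x = ⊤ :=
  not_lt_top_iff.1 hx

theorem effDom_add_coe (ψ : Vec n → EReal) (q : Vec n → ℝ) :
    effDom (fun x => ψ x + (q x : EReal)) = effDom ψ := by
  ext x
  simp only [effDom, Set.mem_ofPred_eq, lt_top_iff_ne_top,
    EReal.add_ne_top_iff_ne_top_left (EReal.coe_ne_bot _) (EReal.coe_ne_top _)]

theorem effDom_coe_mul (ψ : Vec n → EReal) {a : ℝ} (ha : 0 < a) :
    effDom (fun x => (a : EReal) * ψ x) = effDom ψ := by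
  ext x
  simp [effDom, lt_top_iff_ne_top, EReal.mul_eq_top, ha, ha.not_gt]

theorem mem_epsSubdiff_iff {φ : Vec n → ℝ} (hφ : ∀ x ∈ effDom ψ, ψ x = φ x) {ε : ℝ}
    {v z : Vec n} :
    v ∈ epsSubdiff ε ψ z ↔
      z ∈ effDom ψ ∧ ∀ u ∈ effDom ψ, φ z + (⟪v, u - z⟫ - ε) ≤ φ u := by
  refine and_congr_right fun hz => forall_congr' fun u => ?_
  by_cases hu : u ∈ effDom ψ
  · rw [hφ z hz, hφ u hu]
    simp only [hu, forall_const]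
    norm_cast
  · simp [eq_top_of_notMem_effDom hu, hu]

namespace IsProperClosedConvex

theorem coe_toReal (hψ : IsProperClosedConvex ψ) {x : Vec n} (hx : x ∈ effDom ψ) :
    ((ψ x).toReal : EReal) = ψ x :=
  EReal.coe_toReal hx.ne (hψ.ne_bot x)

theorem toReal_le_toReal (hψ : IsProperClosedConvex ψ) {x y : Vec n} (hy : y ∈ effDom ψ)
    (hxy : ψ x ≤ ψ y) : (ψ x).toReal ≤ (ψ y).toReal :=
  EReal.toReal_le_toReal hxy (hψ.ne_bot x) hy.ne

theorem toReal_add_coe (hψ : IsProperClosedConvex ψ) {x : Vec n} (hx : x ∈ effDom ψ) (r : ℝ) :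
    (ψ x + r).toReal = (ψ x).toReal + r := by
  rw [EReal.toReal_add hx.ne (hψ.ne_bot x) (EReal.coe_ne_top r) (EReal.coe_ne_bot r),
    EReal.toReal_coe]

theorem convexOn (hψ : IsProperClosedConvex ψ) :
    ConvexOn ℝ (effDom ψ) fun x => (ψ x).toReal := by
  have combo_le : ∀ x ∈ effDom ψ, ∀ y ∈ effDom ψ, ∀ a b : ℝ, 0 ≤ a → 0 ≤ b → a + b = 1 →
      ψ (a • x + b • y) ≤ ((a * (ψ x).toReal + b * (ψ y).toReal : ℝ) : EReal) := by
    intro x hx y hy a b ha hb hab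
    obtain rfl := eq_sub_of_add_eq' hab
    have := hψ.convex x hx y hy a ⟨ha, sub_nonneg.1 hb⟩
    rw [← hψ.coe_toReal hx, ← hψ.coe_toReal hy] at this
    exact_mod_cast this
  refine ⟨fun x hx y hy a b ha hb hab =>
    (combo_le x hx y hy a b ha hb hab).trans_lt (EReal.coe_lt_top _),
    fun x hx y hy a b ha hb hab => ?_⟩
  exact EReal.toReal_le_toReal (combo_le x hx y hy a b ha hb hab) (hψ.ne_bot _)
    (EReal.coe_ne_top _)

theorem of_convexOn (ne_bot : ∀ x, ψ x ≠ ⊥) (nonempty_dom : (effDom ψ).Nonempty)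
    (lsc : LowerSemicontinuous ψ) (convexOn : ConvexOn ℝ (effDom ψ) fun x => (ψ x).toReal) :
    IsProperClosedConvex ψ where
  ne_bot := ne_bot
  nonempty_dom := nonempty_dom
  lsc := lsc
  convex x hx y hy a ha := by
    have hb : 0 ≤ 1 - a := sub_nonneg.2 ha.2
    have hle := convexOn.2 hx hy ha.1 hb (add_sub_cancel a 1)
    have coe : ∀ z ∈ effDom ψ, ((ψ z).toReal : EReal) = ψ z := fun z hz =>
      EReal.coe_toReal hz.ne (ne_bot z)
    rw [← coe _ (convexOn.1 hx hy ha.1 hb (add_sub_cancel a 1)), ← coe x hx, ← coe y hy]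
    exact_mod_cast hle

theorem add_coe (hψ : IsProperClosedConvex ψ) {q : Vec n → ℝ} (hq : Continuous q)
    (hconv : ConvexOn ℝ (effDom ψ) q) :
    IsProperClosedConvex fun x => ψ x + (q x : EReal) := by
  refine of_convexOn (fun x => EReal.add_ne_bot_iff.2 ⟨hψ.ne_bot x, EReal.coe_ne_bot _⟩) ?_ ?_ ?_
  · rw [effDom_add_coe]
    exact hψ.nonempty_dom
  · exact hψ.lsc.add' (continuous_coe_real_ereal.comp hq).lowerSemicontinuous fun x =>
      EReal.continuousAt_add (Or.inr (EReal.coe_ne_bot _)) (Or.inr (EReal.coe_ne_top _))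
  · rw [effDom_add_coe]
    exact (hψ.convexOn.add hconv).congr fun x hx => (hψ.toReal_add_coe hx _).symm

theorem coe_mul (hψ : IsProperClosedConvex ψ) {a : ℝ} (ha : 0 < a) :
    IsProperClosedConvex fun x => (a : EReal) * ψ x := by
  refine of_convexOn (fun x => ?_) ?_ ?_ ?_
  · simp [EReal.mul_eq_bot, hψ.ne_bot x, ha, ha.not_gt]
  · rw [effDom_coe_mul ψ ha]
    exact hψ.nonempty_dom
  · exact (continuous_iff_continuousAt.2 fun x => EReal.Tendsto.const_mul Filter.tendsto_id
      (Or.inl (EReal.coe_ne_bot _)) (Or.inl (EReal.coe_ne_top _))).comp_lowerSemicontinuous hψ.lsc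
      fun x y hxy => mul_le_mul_of_nonneg_left hxy (EReal.coe_nonneg.2 ha.le)
  · rw [effDom_coe_mul ψ ha]
    simpa only [EReal.toReal_mul, EReal.toReal_coe] using! hψ.convexOn.smul ha.le

theorem exists_forall_le_of_strongConvexOn (hψ : IsProperClosedConvex ψ) {μ : ℝ} (hμ : 0 < μ)
    (hconv : StrongConvexOn (effDom ψ) μ fun x => (ψ x).toReal) : ∃ y, ∀ x, ψ y ≤ ψ x := by
  obtain ⟨p, hp⟩ := hψ.nonempty_dom
  have exists_min_ball : ∀ r : ℝ, 0 ≤ r → ∃ y, ∀ x, ‖x - p‖ ≤ r → ψ y ≤ ψ x := fun r hr => by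
    obtain ⟨y, -, hy⟩ := (hψ.lsc.lowerSemicontinuousOn _).exists_isMinOn
      ⟨p, Metric.mem_closedBall_self hr⟩ (isCompact_closedBall p r)
    exact ⟨y, fun x hx => hy (mem_closedBall_iff_norm.2 hx)⟩
  obtain ⟨a, ha⟩ := exists_min_ball 1 zero_le_one
  have sublevel_bounded : ∀ x ∈ effDom ψ, (ψ x).toReal ≤ (ψ p).toReal →
      ‖x - p‖ ≤ 1 + 2 * ((ψ p).toReal - (ψ a).toReal) / μ := fun x hx hxp =>
    norm_sub_le_of_strongConvexOn hconv hμ hp hx hxp fun y hy hyp =>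
      hψ.toReal_le_toReal hy (ha y hyp)
  have hr := (norm_nonneg _).trans (sublevel_bounded p hp le_rfl)
  obtain ⟨y, hy⟩ := exists_min_ball _ hr
  refine ⟨y, fun x => ?_⟩
  rcases lt_or_ge (ψ p) (ψ x) with hlt | hle
  · exact (hy p (by simpa using hr)).trans hlt.le
  · have hx : x ∈ effDom ψ := hle.trans_lt hp
    exact hy x (sublevel_bounded x hx (hψ.toReal_le_toReal hp hle))

theorem argmin_spec (hψ : IsProperClosedConvex ψ) {μ : ℝ} (hμ : 0 < μ)
    (hconv : StrongConvexOn (effDom ψ) μ fun x => (ψ x).toReal) :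
    argmin ψ ∈ effDom ψ ∧ ∀ x ∈ effDom ψ,
      (ψ (argmin ψ)).toReal + μ / 2 * ‖x - argmin ψ‖ ^ 2 ≤ (ψ x).toReal := by
  have hmin : ∀ x, ψ (argmin ψ) ≤ ψ x := Classical.epsilon_spec
    (p := fun y => ∀ x, ψ y ≤ ψ x) (hψ.exists_forall_le_of_strongConvexOn hμ hconv)
  obtain ⟨p, hp⟩ := hψ.nonempty_dom
  have hdom : argmin ψ ∈ effDom ψ := (hmin p).trans_lt hp
  exact ⟨hdom, fun x hx => add_sq_norm_le_of_strongConvexOn hconv hdom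
    (isMinOn_iff.2 fun y hy => hψ.toReal_le_toReal hy (hmin y)) hx⟩

theorem argmin_add_coe_spec (hψ : IsProperClosedConvex ψ) {μ τ : ℝ} (hμ : 0 ≤ μ) (hτ : 0 < τ)
    (hconv : StrongConvexOn (effDom ψ) μ fun x => (ψ x).toReal) {q : Vec n → ℝ}
    (hq : Continuous q) (hqconv : StrongConvexOn (effDom ψ) τ q) {y : Vec n}
    (hy : y = argmin fun x => ψ x + (q x : EReal)) :
    y ∈ effDom ψ ∧ ∀ x ∈ effDom ψ,
      (ψ y).toReal + q y + (μ + τ) / 2 * ‖x - y‖ ^ 2 ≤ (ψ x).toReal + q x := by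
  have hsum : IsProperClosedConvex fun x => ψ x + (q x : EReal) :=
    hψ.add_coe hq (hqconv.convexOn fun r => by positivity)
  have hsum_conv : StrongConvexOn (effDom fun x => ψ x + (q x : EReal)) (μ + τ)
      fun x => (ψ x + (q x : EReal)).toReal := by
    rw [effDom_add_coe]
    exact strongConvexOn_congr (strongConvexOn_add hconv hqconv) fun x hx =>
      (hψ.toReal_add_coe hx _).symm
  have hspec := hsum.argmin_spec (add_pos_of_nonneg_of_pos hμ hτ) hsum_conv
  rw [← hy, effDom_add_coe] at hspec
  refine ⟨hspec.1, fun x hx => ?_⟩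
  have := hspec.2 x hx
  rwa [hψ.toReal_add_coe hspec.1, hψ.toReal_add_coe hx] at this

end IsProperClosedConvex

end ExtendedReal

/-! ### The ACG method -/

section AffApprox

variable {n : ℕ}

theorem affApprox_combo (ψ : Vec n → ℝ) (w x y : Vec n) {a b : ℝ} (hab : a + b = 1) :
    affApprox ψ (a • x + b • y) w = a * affApprox ψ x w + b * affApprox ψ y w := by
  have hsplit : a • x + b • y - w = a • (x - w) + b • (y - w) := by
    obtain rfl := eq_sub_of_add_eq' hab
    module
  unfold affApprox
  rw [hsplit, inner_add_right, inner_smul_right, inner_smul_right]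
  linear_combination -(ψ w) * hab

theorem convexOn_affApprox (ψ : Vec n → ℝ) (w : Vec n) :
    ConvexOn ℝ Set.univ fun z => affApprox ψ z w :=
  ⟨convex_univ, fun x _ y _ _ _ _ _ hab => (affApprox_combo ψ w x y hab).le⟩

theorem continuous_affApprox (ψ : Vec n → ℝ) (w : Vec n) : Continuous fun z => affApprox ψ z w := by
  unfold affApprox
  fun_prop

end AffApprox

namespace ACGInput

variable {n : ℕ} {I : ACGInput n} {s : ACGState n}

/-- The setting in which the ACG method is analysed: `ψn` is proper, closed and `μ`-strongly convex,
and on its domain `ψs` lies above its affine approximations, by at most `L / 2 ‖· - ·‖²`. -/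
structure Admissible (I : ACGInput n) : Prop where
  conv : IsProperClosedConvex I.ψn
  strong : StrongConvexOn (effDom I.ψn) I.μ fun x => (I.ψn x).toReal
  μ_nonneg : 0 ≤ I.μ
  L_pos : 0 < I.L
  x0_mem : I.x0 ∈ effDom I.ψn
  lower : ∀ z ∈ effDom I.ψn, ∀ w ∈ effDom I.ψn, affApprox I.ψs z w ≤ I.ψs z
  upper : ∀ z ∈ effDom I.ψn, ∀ w ∈ effDom I.ψn,
    I.ψs z ≤ affApprox I.ψs z w + I.L / 2 * ‖z - w‖ ^ 2

/-- The objective `ψs + ψn`, meaningful on the effective domain of `ψn`. -/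
noncomputable def obj (I : ACGInput n) (w : Vec n) : ℝ := I.ψs w + (I.ψn w).toReal

/-- The increment `A_{j+1} - A_j` as a function of `A_j`. -/
noncomputable def stepsize (I : ACGInput n) (A : ℝ) : ℝ :=
  (I.μ * A + 1 + √((I.μ * A + 1) ^ 2 + 4 * I.L * (I.μ * A + 1) * A)) / (2 * I.L)

/-- The point `x̃_j` at which `ψs` is linearized. -/
noncomputable def extrapolation (I : ACGInput n) (s : ACGState n) : Vec n :=
  (s.A / (s.A + I.stepsize s.A)) • s.x + (I.stepsize s.A / (s.A + I.stepsize s.A)) • s.y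

/-- The model `A_j (Γ_j + ψn) + ‖· - x_0‖² / 2`, of which `y_j` is the minimizer. -/
noncomputable def model (I : ACGInput n) (s : ACGState n) (w : Vec n) : ℝ :=
  s.A * (s.Γ w + (I.ψn w).toReal) + 1 / 2 * ‖w - I.x0‖ ^ 2

/-- The estimate-sequence invariant of the ACG method: `Γ_j` minorizes `ψs` (unless `A_j = 0`), and
the minimum of the model, attained at `y_j` with quadratic growth, is at least
`A_j (ψs + ψn)(x_j)`. -/
structure Invariant (I : ACGInput n) (s : ACGState n) : Prop where
  A_nonneg : 0 ≤ s.A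
  x_mem : s.x ∈ effDom I.ψn
  y_mem : s.y ∈ effDom I.ψn
  continuous_Γ : Continuous s.Γ
  convexOn_Γ : ConvexOn ℝ Set.univ s.Γ
  minorant : ∀ z ∈ effDom I.ψn, s.A * s.Γ z ≤ s.A * I.ψs z
  obj_le_model : s.A * I.obj s.x ≤ I.model s s.y
  growth : ∀ w ∈ effDom I.ψn,
    I.model s s.y + (1 + I.μ * s.A) / 2 * ‖w - s.y‖ ^ 2 ≤ I.model s w

theorem Admissible.stepsize_pos (hI : I.Admissible) {A : ℝ} (hA : 0 ≤ A) : 0 < I.stepsize A := by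
  have := mul_nonneg hI.μ_nonneg hA
  have := hI.L_pos
  unfold stepsize
  positivity

theorem Admissible.L_mul_stepsize_sq (hI : I.Admissible) {A : ℝ} (hA : 0 ≤ A) :
    I.L * I.stepsize A ^ 2 = (1 + I.μ * A) * (A + I.stepsize A) := by
  have hμA := mul_nonneg hI.μ_nonneg hA
  have hL := hI.L_pos
  have hdisc := Real.sq_sqrt
    (by positivity : 0 ≤ (I.μ * A + 1) ^ 2 + 4 * I.L * (I.μ * A + 1) * A)
  unfold stepsize
  set r := √((I.μ * A + 1) ^ 2 + 4 * I.L * (I.μ * A + 1) * A)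
  field_simp
  linear_combination hdisc

theorem step_A (I : ACGInput n) (s : ACGState n) : (I.step s).A = s.A + I.stepsize s.A := rfl

theorem step_x (I : ACGInput n) (s : ACGState n) :
    (I.step s).x = (s.A / (s.A + I.stepsize s.A)) • s.x
      + (I.stepsize s.A / (s.A + I.stepsize s.A)) • (I.step s).y := by
  conv_rhs => rw [← add_sub_cancel_left s.A (I.stepsize s.A), add_sub_cancel]
  rfl

theorem step_Γ (I : ACGInput n) (s : ACGState n) (z : Vec n) :
    (I.step s).Γ z = s.A / (s.A + I.stepsize s.A) * s.Γ z
      + I.stepsize s.A / (s.A + I.stepsize s.A) * affApprox I.ψs z (I.extrapolation s) := by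
  have : I.extrapolation s = (s.A / (s.A + I.stepsize s.A)) • s.x
      + ((s.A + I.stepsize s.A - s.A) / (s.A + I.stepsize s.A)) • s.y := by
    rw [add_sub_cancel_left, extrapolation]
  rw [this]
  nth_rw 2 [← add_sub_cancel_left s.A (I.stepsize s.A)]
  rfl

theorem step_y (I : ACGInput n) (s : ACGState n) :
    (I.step s).y = argmin fun w => I.ψn w
      + (((I.step s).Γ w + 1 / (s.A + I.stepsize s.A) / 2 * ‖w - I.x0‖ ^ 2 : ℝ) : EReal) := by
  change argmin (fun w => ((I.step s).Γ w : EReal) + I.ψn w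
    + ((1 / (2 * (s.A + I.stepsize s.A)) * ‖w - I.x0‖ ^ 2 : ℝ) : EReal)) = _
  congr 1
  funext w
  rw [add_comm ((I.step s).Γ w : EReal), add_assoc, ← EReal.coe_add, div_div, mul_comm _ (2 : ℝ)]

theorem Invariant.step_continuous_Γ (hs : I.Invariant s) : Continuous (I.step s).Γ := by
  rw [funext (step_Γ I s)]
  exact (hs.continuous_Γ.const_mul _).add ((continuous_affApprox _ _).const_mul _)

section Step

variable (hI : I.Admissible) (hs : I.Invariant s)
include hI hs

theorem Invariant.stepsize_pos : 0 < I.stepsize s.A := hI.stepsize_pos hs.A_nonneg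

theorem Invariant.step_A_pos : 0 < s.A + I.stepsize s.A :=
  add_pos_of_nonneg_of_pos hs.A_nonneg (hs.stepsize_pos hI)

theorem Invariant.extrapolation_mem : I.extrapolation s ∈ effDom I.ψn :=
  convex_iff_div.1 hI.strong.1 hs.x_mem hs.y_mem hs.A_nonneg (hs.stepsize_pos hI).le
    (hs.step_A_pos hI)

theorem Invariant.step_A_mul_Γ (z : Vec n) :
    (I.step s).A * (I.step s).Γ z
      = s.A * s.Γ z + I.stepsize s.A * affApprox I.ψs z (I.extrapolation s) := by
  have := (hs.step_A_pos hI).ne'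
  rw [step_A, step_Γ]
  field_simp

theorem Invariant.model_step (w : Vec n) :
    I.model (I.step s) w = I.model s w
      + I.stepsize s.A * (affApprox I.ψs w (I.extrapolation s) + (I.ψn w).toReal) := by
  unfold model
  linear_combination hs.step_A_mul_Γ hI w + (I.ψn w).toReal * step_A I s

theorem Invariant.step_convexOn_Γ : ConvexOn ℝ Set.univ (I.step s).Γ := by
  have hA' := (hs.step_A_pos hI).le
  rw [funext (step_Γ I s)]
  exact (hs.convexOn_Γ.smul (div_nonneg hs.A_nonneg hA')).add
    ((convexOn_affApprox _ _).smul (div_nonneg (hs.stepsize_pos hI).le hA'))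

theorem Invariant.step_y_spec :
    (I.step s).y ∈ effDom I.ψn ∧ ∀ w ∈ effDom I.ψn,
      I.model (I.step s) (I.step s).y + (1 + I.μ * (I.step s).A) / 2 * ‖w - (I.step s).y‖ ^ 2
        ≤ I.model (I.step s) w := by
  have hA' := hs.step_A_pos hI
  have hinv : 0 < 1 / (s.A + I.stepsize s.A) := one_div_pos.2 hA'
  have hquad := strongConvexOn_half_mul_norm_sub_sq hI.strong.1 (1 / (s.A + I.stepsize s.A)) I.x0
  have hΓ : StrongConvexOn (effDom I.ψn) 0 (I.step s).Γ := strongConvexOn_zero.2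
    ((hs.step_convexOn_Γ hI).subset (Set.subset_univ _) hI.strong.1)
  have hcont : Continuous fun w =>
      (I.step s).Γ w + 1 / (s.A + I.stepsize s.A) / 2 * ‖w - I.x0‖ ^ 2 :=
    (hs.step_continuous_Γ).add (by fun_prop)
  obtain ⟨hmem, hgrowth⟩ := hI.conv.argmin_add_coe_spec hI.μ_nonneg (by linarith only [hinv])
    hI.strong hcont (strongConvexOn_add hΓ hquad) (step_y I s)
  refine ⟨hmem, fun w hw => ?_⟩
  have := mul_le_mul_of_nonneg_left (hgrowth w hw) hA'.le
  have hcancel : (s.A + I.stepsize s.A) * (1 / (s.A + I.stepsize s.A)) = 1 :=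
    mul_one_div_cancel hA'.ne'
  unfold model
  rw [step_A]
  linear_combination this + (‖w - I.x0‖ ^ 2 - ‖(I.step s).y - I.x0‖ ^ 2
    - ‖w - (I.step s).y‖ ^ 2) / 2 * hcancel

theorem Invariant.step_x_mem : (I.step s).x ∈ effDom I.ψn := by
  rw [step_x]
  exact convex_iff_div.1 hI.strong.1 hs.x_mem (hs.step_y_spec hI).1 hs.A_nonneg
    (hs.stepsize_pos hI).le (hs.step_A_pos hI)

theorem Invariant.step_minorant {z : Vec n} (hz : z ∈ effDom I.ψn) :
    (I.step s).A * (I.step s).Γ z ≤ (I.step s).A * I.ψs z := by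
  rw [hs.step_A_mul_Γ hI, step_A, add_mul]
  exact add_le_add (hs.minorant z hz) (mul_le_mul_of_nonneg_left
    (hI.lower z hz _ (hs.extrapolation_mem hI)) (hs.stepsize_pos hI).le)

theorem Invariant.step_A_mul_affApprox_step_x :
    (I.step s).A * affApprox I.ψs (I.step s).x (I.extrapolation s)
      = s.A * affApprox I.ψs s.x (I.extrapolation s)
        + I.stepsize s.A * affApprox I.ψs (I.step s).y (I.extrapolation s) := by
  have hA' := (hs.step_A_pos hI).ne'
  rw [step_x, affApprox_combo _ _ _ _ (by rw [← add_div, div_self hA']), step_A]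
  field_simp

theorem Invariant.step_A_mul_ψn_step_x_le :
    (I.step s).A * (I.ψn (I.step s).x).toReal
      ≤ s.A * (I.ψn s.x).toReal + I.stepsize s.A * (I.ψn (I.step s).y).toReal := by
  have hA' := hs.step_A_pos hI
  have hle := (convexOn_iff_div.1 hI.conv.convexOn).2 hs.x_mem (hs.step_y_spec hI).1 hs.A_nonneg
    (hs.stepsize_pos hI).le hA'
  rw [← step_x] at hle
  refine (mul_le_mul_of_nonneg_left hle hA'.le).trans_eq ?_
  simp only [smul_eq_mul]
  field_simp

/- The stepsize is chosen so that the error of linearizing `ψs` at `x̃_j` is the gain provided by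
the quadratic growth of the model. -/
theorem Invariant.step_A_mul_sq_norm_step_x_sub :
    (I.step s).A * (I.L / 2 * ‖(I.step s).x - I.extrapolation s‖ ^ 2)
      = (1 + I.μ * s.A) / 2 * ‖(I.step s).y - s.y‖ ^ 2 := by
  have hA' := hs.step_A_pos hI
  rw [step_x, extrapolation, add_sub_add_left_eq_sub, ← smul_sub, norm_smul, mul_pow,
    Real.norm_eq_abs, sq_abs, step_A]
  field_simp
  linear_combination ‖(I.step s).y - s.y‖ ^ 2 * hI.L_mul_stepsize_sq hs.A_nonneg

theorem Invariant.step_obj_le_model :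
    (I.step s).A * I.obj (I.step s).x ≤ I.model (I.step s) (I.step s).y := by
  have hxt := hs.extrapolation_mem hI
  have hy := (hs.step_y_spec hI).1
  have hA' : 0 ≤ (I.step s).A := (hs.step_A_pos hI).le
  have hupper := mul_le_mul_of_nonneg_left (hI.upper _ (hs.step_x_mem hI) _ hxt) hA'
  have hlower := mul_le_mul_of_nonneg_left (hI.lower _ hs.x_mem _ hxt) hs.A_nonneg
  have hquad := hs.step_A_mul_sq_norm_step_x_sub hI
  calc (I.step s).A * I.obj (I.step s).x
      ≤ s.A * I.obj s.x + I.stepsize s.A * (affApprox I.ψs (I.step s).y (I.extrapolation s)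
          + (I.ψn (I.step s).y).toReal) + (1 + I.μ * s.A) / 2 * ‖(I.step s).y - s.y‖ ^ 2 := by
        unfold obj
        linarith only [hupper, hlower, hquad, hs.step_A_mul_affApprox_step_x hI,
          hs.step_A_mul_ψn_step_x_le hI]
    _ ≤ I.model s (I.step s).y + I.stepsize s.A
          * (affApprox I.ψs (I.step s).y (I.extrapolation s) + (I.ψn (I.step s).y).toReal) := by
        linarith only [hs.obj_le_model, hs.growth _ hy]
    _ = I.model (I.step s) (I.step s).y := (hs.model_step hI _).symm

theorem Invariant.step : I.Invariant (I.step s) where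
  A_nonneg := (hs.step_A_pos hI).le
  x_mem := hs.step_x_mem hI
  y_mem := (hs.step_y_spec hI).1
  continuous_Γ := hs.step_continuous_Γ
  convexOn_Γ := hs.step_convexOn_Γ hI
  minorant _ := hs.step_minorant hI
  obj_le_model := hs.step_obj_le_model hI
  growth := (hs.step_y_spec hI).2

end Step

namespace Admissible

theorem invariant (hI : I.Admissible) : ∀ j, I.Invariant (I.iter j)
  | 0 =>
    { A_nonneg := le_rfl
      x_mem := hI.x0_mem
      y_mem := hI.x0_mem
      continuous_Γ := continuous_const
      convexOn_Γ := convexOn_const 0 convex_univ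
      minorant := by simp [iter]
      obj_le_model := by simp [iter, model]
      growth := by simp [iter, model] }
  | j + 1 => (hI.invariant j).step hI

theorem A_nonneg (hI : I.Admissible) (j : ℕ) : 0 ≤ (I.iter j).A := (hI.invariant j).A_nonneg

theorem model_le (hI : I.Admissible) (j : ℕ) {w : Vec n} (hw : w ∈ effDom I.ψn) :
    I.model (I.iter j) w ≤ (I.iter j).A * I.obj w + 1 / 2 * ‖w - I.x0‖ ^ 2 := by
  unfold model obj
  linarith only [(hI.invariant j).minorant w hw]

theorem A_mul_obj_add_le (hI : I.Admissible) (j : ℕ) {w : Vec n} (hw : w ∈ effDom I.ψn) :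
    (I.iter j).A * I.obj (I.x j) + (1 + I.μ * (I.iter j).A) / 2 * ‖w - (I.iter j).y‖ ^ 2
      ≤ (I.iter j).A * I.obj w + 1 / 2 * ‖w - I.x0‖ ^ 2 :=
  (add_le_add_left (hI.invariant j).obj_le_model _).trans
    (((hI.invariant j).growth w hw).trans (hI.model_le j hw))

end Admissible

/-! ### The ACG residuals -/

theorem A_smul_u {j : ℕ} (hA : (I.iter j).A ≠ 0) :
    (I.iter j).A • I.u j = I.x0 - (I.iter j).y := by
  rw [u, smul_smul, mul_one_div_cancel hA, one_smul]

theorem A_mul_obj_add_inner_u_sub_η {j : ℕ} (hA : (I.iter j).A ≠ 0) (w : Vec n) :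
    (I.iter j).A * (I.obj (I.x j) + ⟪I.u j, w - I.x j⟫ - I.η j)
      = I.model (I.iter j) (I.iter j).y + 1 / 2 * ‖w - (I.iter j).y‖ ^ 2
        - 1 / 2 * ‖w - I.x0‖ ^ 2 := by
  have hη : I.η j = I.obj (I.x j) - (I.iter j).Γ (I.iter j).y - (I.ψn (I.iter j).y).toReal
      - ⟪I.u j, I.x j - (I.iter j).y⟫ := rfl
  have hinner : ⟪I.u j, w - I.x j⟫ + ⟪I.u j, I.x j - (I.iter j).y⟫
      = ⟪I.u j, w - (I.iter j).y⟫ := by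
    rw [← inner_add_right, sub_add_sub_cancel]
  have hu : (I.iter j).A * ⟪I.u j, w - (I.iter j).y⟫
      = -⟪(I.iter j).y - I.x0, w - (I.iter j).y⟫ := by
    rw [← real_inner_smul_left, A_smul_u hA, ← inner_neg_left, neg_sub]
  rw [hη, model]
  linear_combination (I.iter j).A * hinner + hu
    + 1 / 2 * norm_sub_sq_eq_add_inner w I.x0 (I.iter j).y

namespace Admissible

variable {j : ℕ}

theorem obj_add_inner_u_sub_η_le (hI : I.Admissible) (hA : 0 < (I.iter j).A) {w : Vec n}
    (hw : w ∈ effDom I.ψn) :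
    I.obj (I.x j) + ⟪I.u j, w - I.x j⟫ - I.η j + I.μ / 2 * ‖w - (I.iter j).y‖ ^ 2
      ≤ I.obj w := by
  refine le_of_mul_le_mul_left ?_ hA
  linarith only [A_mul_obj_add_inner_u_sub_η hA.ne' w, (hI.invariant j).growth w hw,
    hI.model_le j hw]

theorem half_μ_mul_sq_le_η (hI : I.Admissible) (hA : 0 < (I.iter j).A) :
    I.μ / 2 * ‖I.x j - (I.iter j).y‖ ^ 2 ≤ I.η j := by
  have := hI.obj_add_inner_u_sub_η_le hA (hI.invariant j).x_mem
  rw [show (I.iter j).x = I.x j from rfl, sub_self, inner_zero_right] at this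
  linarith only [this]

theorem η_nonneg (hI : I.Admissible) (hA : 0 < (I.iter j).A) : 0 ≤ I.η j :=
  (mul_nonneg (div_nonneg hI.μ_nonneg zero_le_two) (sq_nonneg _)).trans (hI.half_μ_mul_sq_le_η hA)

theorem sq_add_two_mul_A_mul_η_le (hI : I.Admissible) (hA : 0 < (I.iter j).A) :
    ‖I.x j - (I.iter j).y‖ ^ 2 + 2 * (I.iter j).A * I.η j ≤ ‖I.x j - I.x0‖ ^ 2 := by
  have hcert := A_mul_obj_add_inner_u_sub_η hA.ne' (I.x j)
  rw [sub_self, inner_zero_right] at hcert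
  have : (I.iter j).A * I.obj (I.x j) ≤ _ := (hI.invariant j).obj_le_model
  linarith only [hcert, this]

end Admissible

end ACGInput

/-! ### Growth of the ACG coefficients -/

theorem sqrt_add_half_le_sqrt_add {A a r : ℝ} (hA : 0 ≤ A) (ha : 0 < a) (hr : 0 ≤ r)
    (h : a ^ 2 = r ^ 2 * (A + a)) : √A + r / 2 ≤ √(A + a) := by
  have hpos : 0 < √(A + a) := Real.sqrt_pos.2 (by positivity)
  have hsq : √(A + a) ^ 2 = A + a := Real.sq_sqrt (by positivity)
  have ha_eq : a = r * √(A + a) :=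
    (pow_left_inj₀ ha.le (by positivity) two_ne_zero).1 (by rw [mul_pow, hsq, h])
  have hr_le : r ≤ √(A + a) := le_of_mul_le_mul_right (by linarith only [hA, hsq, ha_eq]) hpos
  rw [← le_sub_iff_add_le, Real.sqrt_le_iff]
  constructor
  · linarith only [hr, hr_le]
  · linarith only [hsq, ha_eq, sq_nonneg r]

theorem le_one_add_pow_of_log_le {x t : ℝ} {k : ℕ} (hx : 0 < x) (ht : 0 < t)
    (hk : (1 + 1 / t) * Real.log x ≤ k) : x ≤ (1 + t) ^ k := by
  have hlog : 1 / (1 + 1 / t) ≤ Real.log (1 + t) := by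
    convert Real.one_sub_inv_le_log_of_pos (by positivity : 0 < 1 + t) using 1
    field_simp
    ring
  rw [← Real.log_le_log_iff hx (by positivity), Real.log_pow]
  calc Real.log x = (1 + 1 / t) * Real.log x * (1 / (1 + 1 / t)) := by field_simp
    _ ≤ k * Real.log (1 + t) := mul_le_mul hk hlog (by positivity) k.cast_nonneg

namespace ACGInput

variable {n : ℕ} {I : ACGInput n}

namespace Admissible

theorem sqrt_A_add_le_sqrt_A_succ (hI : I.Admissible) (j : ℕ) :
    √(I.iter j).A + √((1 + I.μ * (I.iter j).A) / I.L) / 2 ≤ √(I.iter (j + 1)).A := by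
  have hA := hI.A_nonneg j
  have hL := hI.L_pos
  have hμA := mul_nonneg hI.μ_nonneg hA
  change _ ≤ √((I.iter j).A + I.stepsize (I.iter j).A)
  refine sqrt_add_half_le_sqrt_add hA (hI.stepsize_pos hA) (Real.sqrt_nonneg _) ?_
  rw [Real.sq_sqrt (by positivity), div_mul_eq_mul_div, ← hI.L_mul_stepsize_sq hA,
    mul_div_cancel_left₀ _ hL.ne']

theorem div_two_mul_sqrt_L_le_sqrt_A (hI : I.Admissible) (j : ℕ) :
    j / (2 * √I.L) ≤ √(I.iter j).A := by
  have hL := hI.L_pos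
  induction j with
  | zero => simp
  | succ j ih =>
    have hμA := mul_nonneg hI.μ_nonneg (hI.A_nonneg j)
    have hincr : 1 / √I.L ≤ √((1 + I.μ * (I.iter j).A) / I.L) := by
      rw [← Real.sqrt_one, ← Real.sqrt_div zero_le_one, Real.sqrt_one]
      gcongr
      exact le_add_of_nonneg_right hμA
    calc ((j + 1 : ℕ) : ℝ) / (2 * √I.L) = j / (2 * √I.L) + 1 / √I.L / 2 := by
          push_cast
          field_simp
      _ ≤ √(I.iter j).A + √((1 + I.μ * (I.iter j).A) / I.L) / 2 := by gcongr
      _ ≤ √(I.iter (j + 1)).A := hI.sqrt_A_add_le_sqrt_A_succ j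

theorem le_A_of_two_mul_sqrt_le (hI : I.Admissible) {B : ℝ} {j : ℕ}
    (hj : 2 * √(I.L * B) ≤ j) : B ≤ (I.iter j).A := by
  have hL := hI.L_pos
  rw [← Real.sqrt_le_sqrt_iff (hI.A_nonneg j)]
  refine le_trans ?_ (hI.div_two_mul_sqrt_L_le_sqrt_A j)
  rw [le_div_iff₀ (by positivity)]
  calc √B * (2 * √I.L) = 2 * √(I.L * B) := by rw [Real.sqrt_mul hL.le]; ring
    _ ≤ j := hj

theorem one_add_pow_div_le_sqrt_A_succ (hI : I.Admissible) (j : ℕ) :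
    (1 + √(I.μ / I.L) / 2) ^ j / (2 * √I.L) ≤ √(I.iter (j + 1)).A := by
  have hL := hI.L_pos
  induction j with
  | zero => simpa using hI.div_two_mul_sqrt_L_le_sqrt_A 1
  | succ j ih =>
    have hincr : √(I.μ / I.L) * √(I.iter (j + 1)).A
        ≤ √((1 + I.μ * (I.iter (j + 1)).A) / I.L) := by
      rw [← Real.sqrt_mul (div_nonneg hI.μ_nonneg hL.le), div_mul_eq_mul_div]
      gcongr
      exact le_add_of_nonneg_left zero_le_one
    calc (1 + √(I.μ / I.L) / 2) ^ (j + 1) / (2 * √I.L)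
        = (1 + √(I.μ / I.L) / 2) * ((1 + √(I.μ / I.L) / 2) ^ j / (2 * √I.L)) := by ring
      _ ≤ (1 + √(I.μ / I.L) / 2) * √(I.iter (j + 1)).A := by gcongr
      _ ≤ √(I.iter (j + 1)).A + √((1 + I.μ * (I.iter (j + 1)).A) / I.L) / 2 := by
          linarith only [hincr]
      _ ≤ √(I.iter (j + 1 + 1)).A := hI.sqrt_A_add_le_sqrt_A_succ (j + 1)

theorem le_A_succ_of_log_le (hI : I.Admissible) (hμ : 0 < I.μ) {B : ℝ} (hB : 0 < B) {k : ℕ}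
    (hk : (1 + 2 * √(I.L / I.μ)) * Real.log (2 * √(I.L * B)) ≤ k) :
    B ≤ (I.iter (k + 1)).A := by
  have hL := hI.L_pos
  have hinv : 1 / (√(I.μ / I.L) / 2) = 2 * √(I.L / I.μ) := by
    rw [one_div_div, div_eq_mul_inv, ← Real.sqrt_inv, inv_div]
  have hpow : 2 * √(I.L * B) ≤ (1 + √(I.μ / I.L) / 2) ^ k :=
    le_one_add_pow_of_log_le (by positivity) (by positivity) (by rwa [hinv])
  rw [← Real.sqrt_le_sqrt_iff (hI.A_nonneg _)]
  refine le_trans ?_ (hI.one_add_pow_div_le_sqrt_A_succ k)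
  rw [le_div_iff₀ (by positivity)]
  calc √B * (2 * √I.L) = 2 * √(I.L * B) := by rw [Real.sqrt_mul hL.le]; ring
    _ ≤ (1 + √(I.μ / I.L) / 2) ^ k := hpow

end Admissible

/-! ### Late ACG iterates are approximate solutions -/

section LateIterates

variable {j : ℕ}

namespace Admissible

theorem one_add_μ_mul_A_mul_sq_le (hI : I.Admissible) (hA : 0 < (I.iter j).A) :
    (1 + I.μ * (I.iter j).A) * ‖I.x j - (I.iter j).y‖ ^ 2 ≤ ‖I.x j - I.x0‖ ^ 2 := by
  have := mul_le_mul_of_nonneg_left (hI.half_μ_mul_sq_le_η hA) hA.le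
  linarith only [this, hI.sq_add_two_mul_A_mul_η_le hA]

theorem A_pos_of_nine_le (hI : I.Admissible) (hμA : 9 ≤ I.μ * (I.iter j).A) : 0 < (I.iter j).A :=
  pos_of_mul_pos_right (by linarith only [hμA]) hI.μ_nonneg

theorem norm_x_sub_y_le (hI : I.Admissible) (hμA : 9 ≤ I.μ * (I.iter j).A) :
    ‖I.x j - (I.iter j).y‖ ≤ 1 / 3 * ‖I.x j - I.x0‖ := by
  have hle := hI.one_add_μ_mul_A_mul_sq_le (hI.A_pos_of_nine_le hμA)
  have := mul_le_mul_of_nonneg_right hμA (sq_nonneg ‖I.x j - (I.iter j).y‖)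
  refine le_of_sq_le_sq ?_ (by positivity)
  linarith only [hle, this, sq_nonneg ‖I.x j - (I.iter j).y‖]

theorem A_mul_norm_u_le (hI : I.Admissible) (hμA : 9 ≤ I.μ * (I.iter j).A) :
    (I.iter j).A * ‖I.u j‖ ≤ 4 / 3 * ‖I.x j - I.x0‖ := by
  have hA := hI.A_pos_of_nine_le hμA
  calc (I.iter j).A * ‖I.u j‖ = ‖I.x0 - (I.iter j).y‖ := by
        rw [← A_smul_u hA.ne', norm_smul, Real.norm_of_nonneg hA.le]
    _ ≤ ‖I.x0 - I.x j‖ + ‖I.x j - (I.iter j).y‖ := norm_sub_le_norm_sub_add_norm_sub _ _ _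
    _ ≤ 4 / 3 * ‖I.x j - I.x0‖ := by
        rw [norm_sub_rev]
        linarith only [hI.norm_x_sub_y_le hμA]

theorem norm_u_le (hI : I.Admissible) (hμA : 9 ≤ I.μ * (I.iter j).A) (hA : 18 ≤ (I.iter j).A) :
    ‖I.u j‖ ≤ 2 / 27 * ‖I.x j - I.x0‖ := by
  have := mul_le_mul_of_nonneg_right hA (norm_nonneg (I.u j))
  linarith only [this, hI.A_mul_norm_u_le hμA]

theorem norm_x_sub_x0_le (hI : I.Admissible) (hμA : 9 ≤ I.μ * (I.iter j).A)
    (hA : 18 ≤ (I.iter j).A) : 25 / 27 * ‖I.x j - I.x0‖ ≤ ‖I.x0 - I.x j + I.u j‖ := by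
  have htri := norm_sub_le (I.x0 - I.x j + I.u j) (I.u j)
  rw [add_sub_cancel_right, norm_sub_rev] at htri
  linarith only [htri, hI.norm_u_le hμA hA]

theorem sq_norm_u_add_le (hI : I.Admissible) (hμA : 9 ≤ I.μ * (I.iter j).A)
    (hA : 18 ≤ (I.iter j).A) {σ : ℝ} (hσA : 18 ≤ σ * (I.iter j).A) :
    ‖I.u j‖ ^ 2 + 2 * I.η j ≤ σ * ‖I.x0 - I.x j + I.u j‖ ^ 2 := by
  have hApos := hI.A_pos_of_nine_le hμA
  have hu := mul_le_mul (hI.A_mul_norm_u_le hμA) (hI.norm_u_le hμA hA) (norm_nonneg _)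
    (by positivity)
  have hη := hI.sq_add_two_mul_A_mul_η_le hApos
  have hx := pow_le_pow_left₀ (by positivity) (hI.norm_x_sub_x0_le hμA hA) 2
  refine le_of_mul_le_mul_left ?_ hApos
  calc (I.iter j).A * (‖I.u j‖ ^ 2 + 2 * I.η j) ≤ 2 * ‖I.x j - I.x0‖ ^ 2 := by
        linarith only [hu, hη, sq_nonneg ‖I.x j - (I.iter j).y‖, sq_nonneg ‖I.x j - I.x0‖]
    _ ≤ 18 * ‖I.x0 - I.x j + I.u j‖ ^ 2 := by linarith only [hx, sq_nonneg ‖I.x j - I.x0‖]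
    _ ≤ σ * (I.iter j).A * ‖I.x0 - I.x j + I.u j‖ ^ 2 := by gcongr
    _ = (I.iter j).A * (σ * ‖I.x0 - I.x j + I.u j‖ ^ 2) := by ring

theorem obj_x_add_sq_le (hI : I.Admissible) (hμA : 9 ≤ I.μ * (I.iter j).A) {w : Vec n}
    (hw : w ∈ effDom I.ψn) :
    I.obj (I.x j) + I.μ / 2 * ‖w - (I.iter j).y‖ ^ 2
      ≤ I.obj w + I.μ / 18 * ‖w - I.x0‖ ^ 2 := by
  refine le_of_mul_le_mul_left ?_ (hI.A_pos_of_nine_le hμA)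
  have := mul_le_mul_of_nonneg_right hμA (sq_nonneg ‖w - I.x0‖)
  linarith only [hI.A_mul_obj_add_le j hw, this, sq_nonneg ‖w - (I.iter j).y‖]

theorem norm_x_sub_x0_le_mul_norm_x_sub_x0 (hI : I.Admissible) {i : ℕ}
    (hi : 9 ≤ I.μ * (I.iter i).A) (hj : 9 ≤ I.μ * (I.iter j).A) :
    ‖I.x i - I.x0‖ ≤ 5 / 2 * ‖I.x j - I.x0‖ := by
  have hμ : 0 < I.μ := pos_of_mul_pos_left (by linarith only [hj]) (hI.A_nonneg j)
  have hij := hI.obj_x_add_sq_le hj (hI.invariant i).x_mem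
  have hji := hI.obj_x_add_sq_le hi (hI.invariant j).x_mem
  have hcross : ‖I.x i - (I.iter j).y‖ ^ 2 ≤ (‖I.x i - I.x0‖ ^ 2 + ‖I.x j - I.x0‖ ^ 2) / 9 := by
    refine le_of_mul_le_mul_left ?_ hμ
    have := mul_nonneg hμ.le (sq_nonneg ‖(I.iter j).x - (I.iter i).y‖)
    simp only [x] at hij hji ⊢
    linarith only [hij, hji, this]
  have hxy : ‖I.x i - (I.iter j).y‖ ≤ (‖I.x i - I.x0‖ + ‖I.x j - I.x0‖) / 3 := by
    refine le_of_sq_le_sq (hcross.trans ?_) (by positivity)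
    have := mul_nonneg (norm_nonneg (I.x i - I.x0)) (norm_nonneg (I.x j - I.x0))
    linarith only [this]
  have htri := norm_sub_le_norm_sub_add_norm_sub (I.x i) (I.iter j).y I.x0
  have htri' := norm_sub_le_norm_sub_add_norm_sub (I.iter j).y (I.x j) I.x0
  rw [norm_sub_rev _ (I.x j)] at htri'
  linarith only [htri, htri', hxy, hI.norm_x_sub_y_le hj]

end Admissible

end LateIterates

end ACGInput

/-! ### The prox subproblems of the AIPP method -/

namespace AIPPInput

variable {n : ℕ} {I : AIPPInput n}

/-- The setting in which the AIPP method is analysed: `h` is proper, closed and convex, the stepsize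
`λ` is small enough for `λ g + ‖· - z‖² / 4` to be convex, and the tolerance `ε` is not too small
compared with `ρ`. The inequalities on `g` are only required on the effective domain of `h`. -/
structure Regular (I : AIPPInput n) : Prop where
  conv : IsProperClosedConvex I.h
  lam_pos : 0 < I.lam
  diff : ∀ z ∈ effDom I.h, DifferentiableAt ℝ I.g z
  lower : ∀ u ∈ effDom I.h, ∀ z ∈ effDom I.h,
    I.lam * affApprox I.g u z - 1 / 4 * ‖u - z‖ ^ 2 ≤ I.lam * I.g u
  upper : ∀ u ∈ effDom I.h, ∀ z ∈ effDom I.h,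
    I.g u ≤ affApprox I.g u z + I.M / 2 * ‖u - z‖ ^ 2
  half_le_lam_mul_M : 1 / 2 ≤ I.lam * I.M
  σ_pos : 0 < I.σ
  σ_lt_one : I.σ < 1
  ρ_pos : 0 < I.ρ
  tolerance : 9 * I.lam * I.ρ ^ 2 ≤ 50 * (I.lam * I.M + 1 / 2) * I.ε

/-- The objective `g + h`, meaningful on the effective domain of `h`. -/
noncomputable def val (I : AIPPInput n) (w : Vec n) : ℝ := I.g w + (I.h w).toReal

/-- The upper curvature `L = λ M + 1 / 2` of the smooth part of the prox subproblems. -/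
noncomputable def curv (I : AIPPInput n) : ℝ := I.lam * I.M + 1 / 2

theorem Regular.one_le_curv (hI : I.Regular) : 1 ≤ I.curv := by
  unfold curv
  linarith only [hI.half_le_lam_mul_M]

theorem Regular.curv_le_div_σ (hI : I.Regular) : I.curv ≤ I.curv / I.σ :=
  le_div_self (zero_le_one.trans hI.one_le_curv) hI.σ_pos hI.σ_lt_one.le

theorem effDom_acg_ψn (I : AIPPInput n) (hlam : 0 < I.lam) (z : Vec n) :
    effDom (I.acg z).ψn = effDom I.h :=
  (effDom_add_coe _ _).trans (effDom_coe_mul _ hlam)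

theorem Regular.toReal_acg_ψn (hI : I.Regular) (z : Vec n) {w : Vec n} (hw : w ∈ effDom I.h) :
    ((I.acg z).ψn w).toReal = I.lam * (I.h w).toReal + 1 / 4 * ‖w - z‖ ^ 2 := by
  change ((I.lam : EReal) * I.h w + ((1 / 4 * ‖w - z‖ ^ 2 : ℝ) : EReal)).toReal = _
  rw [← effDom_coe_mul I.h hI.lam_pos] at hw
  rw [(hI.conv.coe_mul hI.lam_pos).toReal_add_coe hw, EReal.toReal_mul, EReal.toReal_coe]

theorem affApprox_acg_ψs (I : AIPPInput n) (z u : Vec n) {w : Vec n}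
    (hw : DifferentiableAt ℝ I.g w) :
    affApprox (I.acg z).ψs u w
      = I.lam * affApprox I.g u w + 1 / 4 * ‖u - z‖ ^ 2 - 1 / 4 * ‖u - w‖ ^ 2 := by
  have hgrad : gradient (I.acg z).ψs w = I.lam • gradient I.g w + (2 * (1 / 4 : ℝ)) • (w - z) :=
    (hasGradientAt_mul_add_sq hw.hasGradientAt I.lam (1 / 4) z).gradient
  unfold affApprox
  rw [hgrad, inner_add_left, real_inner_smul_left, real_inner_smul_left]
  change I.lam * I.g w + 1 / 4 * ‖w - z‖ ^ 2 + _ = _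
  linear_combination (-1 / 4) * norm_sub_sq_eq_add_inner u z w

theorem Regular.acg_admissible (hI : I.Regular) {z : Vec n} (hz : z ∈ effDom I.h) :
    (I.acg z).Admissible where
  conv := (hI.conv.coe_mul hI.lam_pos).add_coe (by fun_prop)
    ((strongConvexOn_half_mul_norm_sub_sq
      (by rw [effDom_coe_mul _ hI.lam_pos]; exact hI.conv.convexOn.1) (1 / 2) z).convexOn
        (fun r => by positivity) |>.congr fun w _ => by ring)
  strong := by
    rw [effDom_acg_ψn I hI.lam_pos]
    have hsum := strongConvexOn_add
      (strongConvexOn_zero.2 (hI.conv.convexOn.smul hI.lam_pos.le))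
      (strongConvexOn_half_mul_norm_sub_sq hI.conv.convexOn.1 (1 / 2) z)
    rw [zero_add] at hsum
    refine strongConvexOn_congr hsum fun w hw => ?_
    rw [hI.toReal_acg_ψn z hw]
    norm_num
  μ_nonneg := one_half_pos.le
  L_pos := zero_lt_one.trans_le hI.one_le_curv
  x0_mem := by
    rw [effDom_acg_ψn I hI.lam_pos]
    exact hz
  lower u hu w hw := by
    rw [effDom_acg_ψn I hI.lam_pos] at hu hw
    rw [affApprox_acg_ψs I z u (hI.diff w hw)]
    change _ ≤ I.lam * I.g u + 1 / 4 * ‖u - z‖ ^ 2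
    linarith only [hI.lower u hu w hw]
  upper u hu w hw := by
    rw [effDom_acg_ψn I hI.lam_pos] at hu hw
    rw [affApprox_acg_ψs I z u (hI.diff w hw)]
    change I.lam * I.g u + 1 / 4 * ‖u - z‖ ^ 2 ≤ _ + (I.lam * I.M + 1 / 2) / 2 * _
    linarith only [mul_le_mul_of_nonneg_left (hI.upper u hu w hw) hI.lam_pos.le]

theorem Regular.acg_x_mem (hI : I.Regular) {z : Vec n} (hz : z ∈ effDom I.h) (j : ℕ) :
    (I.acg z).x j ∈ effDom I.h := by
  rw [← effDom_acg_ψn I hI.lam_pos z]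
  exact ((hI.acg_admissible hz).invariant j).x_mem

theorem Regular.acg_obj (hI : I.Regular) (z : Vec n) {w : Vec n} (hw : w ∈ effDom I.h) :
    (I.acg z).obj w = I.lam * I.val w + 1 / 2 * ‖w - z‖ ^ 2 := by
  have hψs : (I.acg z).ψs w = I.lam * I.g w + 1 / 4 * ‖w - z‖ ^ 2 := rfl
  rw [ACGInput.obj, hI.toReal_acg_ψn z hw, hψs, val]
  ring

theorem Regular.isProxApprox_iff (hI : I.Regular) {z x u : Vec n} {η : ℝ} :
    I.IsProxApprox z x u η ↔ 0 ≤ η ∧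
      (x ∈ effDom I.h ∧ ∀ w ∈ effDom I.h,
        I.lam * I.val x + 1 / 2 * ‖x - z‖ ^ 2 + (⟪u, w - x⟫ - η)
          ≤ I.lam * I.val w + 1 / 2 * ‖w - z‖ ^ 2) ∧
      ‖u‖ ^ 2 + 2 * η ≤ I.σ * ‖z - x + u‖ ^ 2 := by
  have hdom : effDom (fun w => (I.lam : EReal) * ((I.g w : EReal) + I.h w)
      + ((1 / 2 * ‖w - z‖ ^ 2 : ℝ) : EReal)) = effDom I.h := by
    rw [effDom_add_coe, effDom_coe_mul _ hI.lam_pos]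
    simp only [add_comm (I.g _ : EReal), effDom_add_coe]
  rw [IsProxApprox, mem_epsSubdiff_iff (φ := fun w => I.lam * I.val w + 1 / 2 * ‖w - z‖ ^ 2), hdom]
  intro w hw
  rw [hdom] at hw
  beta_reduce
  rw [← hI.conv.coe_toReal hw, val]
  norm_cast

section Subproblem

variable {z : Vec n} {j : ℕ}

theorem nine_le_acg_μ_mul_A (I : AIPPInput n) (z : Vec n) (hA : 18 ≤ ((I.acg z).iter j).A) :
    9 ≤ (I.acg z).μ * ((I.acg z).iter j).A := by
  change 9 ≤ 1 / 2 * _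
  linarith only [hA]

theorem Regular.isProxApprox_acg (hI : I.Regular) (hz : z ∈ effDom I.h)
    (hA : 18 ≤ I.σ * ((I.acg z).iter j).A) :
    I.IsProxApprox z ((I.acg z).x j) ((I.acg z).u j) ((I.acg z).η j) := by
  have hadm := hI.acg_admissible hz
  have hA18 : 18 ≤ ((I.acg z).iter j).A :=
    hA.trans (mul_le_of_le_one_left (hadm.A_nonneg j) hI.σ_lt_one.le)
  have hApos : 0 < ((I.acg z).iter j).A := by linarith only [hA18]
  refine hI.isProxApprox_iff.2 ⟨hadm.η_nonneg hApos, ⟨hI.acg_x_mem hz j, fun w hw => ?_⟩,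
    hadm.sq_norm_u_add_le (nine_le_acg_μ_mul_A I z hA18) hA18 hA⟩
  rw [← hI.acg_obj z hw, ← hI.acg_obj z (hI.acg_x_mem hz j)]
  have hsub := hadm.obj_add_inner_u_sub_η_le hApos (by rwa [effDom_acg_ψn I hI.lam_pos z])
  have := mul_nonneg (div_nonneg hadm.μ_nonneg zero_le_two) (sq_nonneg ‖w - ((I.acg z).iter j).y‖)
  linarith only [hsub, this]

/-- A number of ACG iterations after which every iterate is a `σ`-approximate solution. -/
noncomputable def approxIters (I : AIPPInput n) : ℕ := ⌈9 * √(I.curv / I.σ)⌉₊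

/-- A number of ACG iterations after which every iterate moreover meets the tolerance on `η`. -/
noncomputable def accurateIters (I : AIPPInput n) : ℕ :=
  max I.approxIters (⌈4 * √I.curv * Real.log (2 * I.curv)⌉₊ + 1)

theorem Regular.ceil_le_approxIters (hI : I.Regular) :
    ⌈6 * √(2 * I.lam * I.M + 1)⌉₊ ≤ I.approxIters := by
  have hc := hI.one_le_curv
  have hσ := hI.σ_pos
  have htwo : 2 * I.lam * I.M + 1 = 2 * I.curv := by unfold curv; ring
  refine Nat.ceil_le_ceil (le_of_sq_le_sq ?_ (by positivity))
  rw [htwo, mul_pow, mul_pow, Real.sq_sqrt (by positivity), Real.sq_sqrt (by positivity)]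
  linarith only [hc, hI.curv_le_div_σ]

theorem Regular.eighteen_le_A (hI : I.Regular) (hz : z ∈ effDom I.h)
    (hj : ⌈6 * √(2 * I.lam * I.M + 1)⌉₊ ≤ j) : 18 ≤ ((I.acg z).iter j).A := by
  refine (hI.acg_admissible hz).le_A_of_two_mul_sqrt_le (le_trans (le_of_eq ?_) (Nat.ceil_le.1 hj))
  change 2 * √((I.lam * I.M + 1 / 2) * 18) = _
  rw [show (I.lam * I.M + 1 / 2) * 18 = 3 ^ 2 * (2 * I.lam * I.M + 1) by ring,
    Real.sqrt_mul (by norm_num), Real.sqrt_sq (by norm_num)]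
  ring

theorem Regular.eighteen_le_σ_mul_A (hI : I.Regular) (hz : z ∈ effDom I.h)
    (hj : I.approxIters ≤ j) : 18 ≤ I.σ * ((I.acg z).iter j).A := by
  have hc := hI.one_le_curv
  have hσ := hI.σ_pos
  rw [← div_le_iff₀' hσ]
  refine (hI.acg_admissible hz).le_A_of_two_mul_sqrt_le (le_trans ?_ (Nat.ceil_le.1 hj))
  change 2 * √(I.curv * (18 / I.σ)) ≤ _
  refine le_of_sq_le_sq ?_ (by positivity)
  rw [mul_pow, mul_pow, Real.sq_sqrt (by positivity), Real.sq_sqrt (by positivity),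
    mul_div_left_comm]
  linarith only [hc, hI.curv_le_div_σ]

theorem Regular.curv_le_A (hI : I.Regular) (hz : z ∈ effDom I.h) (hj : I.accurateIters ≤ j) :
    I.curv ≤ ((I.acg z).iter j).A := by
  have hc := hI.one_le_curv
  have hj' : ⌈4 * √I.curv * Real.log (2 * I.curv)⌉₊ + 1 ≤ j := (le_max_right _ _).trans hj
  obtain ⟨k, rfl⟩ : ∃ k, j = k + 1 := Nat.exists_eq_succ_of_ne_zero (by omega)
  have hk : 4 * √I.curv * Real.log (2 * I.curv) ≤ k := Nat.ceil_le.1 (by omega)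
  refine (hI.acg_admissible hz).le_A_succ_of_log_le one_half_pos (zero_lt_one.trans_le hc)
    (le_trans ?_ hk)
  change (1 + 2 * √(I.curv / (1 / 2))) * Real.log (2 * √(I.curv * I.curv)) ≤ _
  have hone : 1 ≤ √I.curv := Real.one_le_sqrt.2 hc
  have hsqrt : √(I.curv / (1 / 2)) ≤ 3 / 2 * √I.curv := by
    refine le_of_sq_le_sq ?_ (by positivity)
    rw [mul_pow, Real.sq_sqrt (by positivity), Real.sq_sqrt (by positivity)]
    linarith only [hc]
  have hlog : 0 ≤ Real.log (2 * I.curv) := Real.log_nonneg (by linarith only [hc])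
  rw [Real.sqrt_mul_self (by positivity)]
  exact mul_le_mul_of_nonneg_right (by linarith only [hone, hsqrt]) hlog

/-! ### The stopping tests of the AIPP method -/

theorem Regular.approxIters_mem (hI : I.Regular) (hz : z ∈ effDom I.h) :
    ⌈6 * √(2 * I.lam * I.M + 1)⌉₊ ≤ I.approxIters ∧
      I.IsProxApprox z ((I.acg z).x I.approxIters) ((I.acg z).u I.approxIters)
        ((I.acg z).η I.approxIters) :=
  ⟨hI.ceil_le_approxIters, hI.isProxApprox_acg hz (hI.eighteen_le_σ_mul_A hz le_rfl)⟩

theorem Regular.exists_isStepOne (hI : I.Regular) (hz : z ∈ effDom I.h) : ∃ j, I.IsStepOne z j :=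
  ⟨_, isLeast_csInf ⟨_, hI.approxIters_mem hz⟩⟩

theorem Regular.isStepOne_le (hI : I.Regular) (hz : z ∈ effDom I.h) (hj : I.IsStepOne z j) :
    j ≤ I.approxIters :=
  hj.2 (hI.approxIters_mem hz)

section LastOuterIteration

variable (hI : I.Regular) (hz : z ∈ effDom I.h) (hj : I.IsStepOne z j)
  (hr : ‖z - (I.acg z).x j + (I.acg z).u j‖ ≤ I.lam * I.ρ / 5)
include hI hz hj hr

theorem Regular.norm_acg_x_sub_le {i : ℕ} (hi : j ≤ i) :
    ‖(I.acg z).x i - z‖ ≤ 27 / 10 * (I.lam * I.ρ / 5) := by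
  have hadm := hI.acg_admissible hz
  have hAj := hI.eighteen_le_A hz hj.1.1
  have hAi := hI.eighteen_le_A hz (hj.1.1.trans hi)
  have hij : ‖(I.acg z).x i - z‖ ≤ 5 / 2 * ‖(I.acg z).x j - z‖ :=
    hadm.norm_x_sub_x0_le_mul_norm_x_sub_x0 (nine_le_acg_μ_mul_A I z hAi)
      (nine_le_acg_μ_mul_A I z hAj)
  have hjr : 25 / 27 * ‖(I.acg z).x j - z‖ ≤ ‖z - (I.acg z).x j + (I.acg z).u j‖ :=
    hadm.norm_x_sub_x0_le (nine_le_acg_μ_mul_A I z hAj) hAj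
  linarith only [hij, hjr, hr]

theorem Regular.norm_acg_residual_le {i : ℕ} (hi : j ≤ i) :
    ‖z - (I.acg z).x i + (I.acg z).u i‖ ≤ 3 * (I.lam * I.ρ / 5) := by
  have hAi := hI.eighteen_le_A hz (hj.1.1.trans hi)
  have hx := hI.norm_acg_x_sub_le hz hj hr hi
  have hu : ‖(I.acg z).u i‖ ≤ 2 / 27 * ‖(I.acg z).x i - z‖ :=
    (hI.acg_admissible hz).norm_u_le (nine_le_acg_μ_mul_A I z hAi) hAi
  have htri := norm_add_le (z - (I.acg z).x i) ((I.acg z).u i)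
  rw [norm_sub_rev] at htri
  linarith only [hx, hu, htri, (norm_nonneg _).trans hr]

theorem Regular.η_div_lam_le {i : ℕ} (hi : j ≤ i) (hA : I.curv ≤ ((I.acg z).iter i).A) :
    (I.acg z).η i / I.lam ≤ I.ε := by
  have hadm := hI.acg_admissible hz
  have hc : 0 < I.curv := zero_lt_one.trans_le hI.one_le_curv
  have hApos := hc.trans_le hA
  have hlam := hI.lam_pos
  have hx := pow_le_pow_left₀ (norm_nonneg _) (hI.norm_acg_x_sub_le hz hj hr hi) 2
  have hη : _ ≤ ‖(I.acg z).x i - z‖ ^ 2 := hadm.sq_add_two_mul_A_mul_η_le hApos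
  have hcurv := mul_le_mul_of_nonneg_right hA (hadm.η_nonneg hApos)
  have htol : _ ≤ I.lam * (50 * I.curv * I.ε) := mul_le_mul_of_nonneg_left hI.tolerance hlam.le
  rw [div_le_iff₀ hlam]
  refine le_of_mul_le_mul_left ?_ hc
  linarith only [hx, hη, hcurv, htol, sq_nonneg ‖(I.acg z).x i - ((I.acg z).iter i).y‖,
    sq_nonneg (I.lam * I.ρ)]

theorem Regular.accurateIters_mem :
    j ≤ I.accurateIters ∧
      I.IsProxApprox z ((I.acg z).x I.accurateIters) ((I.acg z).u I.accurateIters)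
        ((I.acg z).η I.accurateIters) ∧
      (I.acg z).η I.accurateIters / I.lam ≤ I.ε := by
  have hj_le : j ≤ I.accurateIters := (hI.isStepOne_le hz hj).trans (le_max_left _ _)
  exact ⟨hj_le, hI.isProxApprox_acg hz (hI.eighteen_le_σ_mul_A hz (le_max_left _ _)),
    hI.η_div_lam_le hz hj hr hj_le (hI.curv_le_A hz le_rfl)⟩

theorem Regular.exists_isStepThree : ∃ j', I.IsStepThree z j j' :=
  ⟨_, isLeast_csInf ⟨_, hI.accurateIters_mem hz hj hr⟩⟩

theorem Regular.isStepThree_le {j' : ℕ} (hj' : I.IsStepThree z j j') : j' ≤ I.accurateIters :=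
  hj'.2 (hI.accurateIters_mem hz hj hr)

end LastOuterIteration

end Subproblem

/-! ### Descent along approximate prox steps -/

theorem Regular.val_add_le_of_isProxApprox (hI : I.Regular) {z x u : Vec n} {η : ℝ}
    (hz : z ∈ effDom I.h) (h : I.IsProxApprox z x u η) :
    I.lam * I.val x + (1 - I.σ) / 2 * ‖z - x + u‖ ^ 2 ≤ I.lam * I.val z := by
  obtain ⟨-, ⟨-, hsub⟩, herr⟩ := hI.isProxApprox_iff.1 h
  have hz_sub := hsub z hz
  have hsq := norm_add_sq_real (z - x) u
  rw [sub_self, norm_zero] at hz_sub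
  rw [real_inner_comm, norm_sub_rev] at hsq
  linarith only [hz_sub, hsq, herr]

theorem Regular.one_sub_σ_mul_val_le_of_isProxApprox (hI : I.Regular) {z x u w : Vec n} {η : ℝ}
    (hw : w ∈ effDom I.h) (h : I.IsProxApprox z x u η) :
    (1 - I.σ) * (I.lam * I.val x) ≤ (1 - I.σ) * (I.lam * I.val w) + 1 / 2 * ‖z - w‖ ^ 2 := by
  have hσ := hI.σ_pos
  have hσ1 : 0 ≤ 1 - I.σ := sub_nonneg.2 hI.σ_lt_one.le
  obtain ⟨hη, ⟨-, hsub⟩, herr⟩ := hI.isProxApprox_iff.1 h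
  have hsq := norm_add_sq_real (z - x) u
  rw [real_inner_comm, norm_sub_rev] at hsq
  have hinner : ⟪u, w - x⟫ = ⟪u, z - x⟫ - ⟪u, z - w⟫ := by
    rw [← inner_sub_right, sub_sub_sub_cancel_left]
  have hcs := real_inner_le_norm u (z - w)
  have hval : I.lam * I.val x ≤ I.lam * I.val w + 1 / 2 * ‖z - w‖ ^ 2 + ‖u‖ * ‖z - w‖
      - (1 - I.σ) / 2 * ‖z - x + u‖ ^ 2 := by
    have hw_sub := hsub w hw
    rw [norm_sub_rev w z] at hw_sub
    linarith only [hw_sub, hsq, hinner, hcs, herr]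
  have hamgm : (1 - I.σ) * (‖u‖ * ‖z - w‖)
      ≤ (1 - I.σ) ^ 2 / 2 * ‖z - x + u‖ ^ 2 + I.σ / 2 * ‖z - w‖ ^ 2 := by
    have hu : ‖u‖ ^ 2 ≤ I.σ * ‖z - x + u‖ ^ 2 := by linarith only [herr, hη]
    refine le_of_mul_le_mul_left ?_ hσ
    linarith only [sq_nonneg ((1 - I.σ) * ‖u‖ - I.σ * ‖z - w‖),
      mul_le_mul_of_nonneg_left hu (sq_nonneg (1 - I.σ))]
  linarith only [mul_le_mul_of_nonneg_left hval hσ1, hamgm]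

/-- The guaranteed decrease of `λ (g + h)` in an outer iteration which is not the last. -/
noncomputable def decrease (I : AIPPInput n) : ℝ := (1 - I.σ) / 2 * (I.lam * I.ρ / 5) ^ 2

theorem Regular.decrease_pos (hI : I.Regular) : 0 < I.decrease := by
  have hσ := sub_pos.2 hI.σ_lt_one
  have hlam := hI.lam_pos
  have hρ := hI.ρ_pos
  unfold decrease
  positivity

theorem Regular.val_add_decrease_le (hI : I.Regular) {z : Vec n} (hz : z ∈ effDom I.h) {j : ℕ}
    (hj : I.IsStepOne z j) (hr : I.lam * I.ρ / 5 < ‖z - (I.acg z).x j + (I.acg z).u j‖) :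
    I.lam * I.val ((I.acg z).x j) + I.decrease ≤ I.lam * I.val z := by
  have hσ := sub_nonneg.2 hI.σ_lt_one.le
  have hlam := hI.lam_pos
  have hρ := hI.ρ_pos
  refine le_trans ?_ (hI.val_add_le_of_isProxApprox hz hj.1.2)
  unfold decrease
  gcongr

/-! ### Runs of the AIPP method -/

section Runs

variable {m : ℝ} {z : Vec n} {out : AIPPOutput n} {N : ℕ}

theorem Regular.exists_run (hI : I.Regular) (hm : ∀ w ∈ effDom I.h, m ≤ I.val w)
    (hz : z ∈ effDom I.h) : ∃ out N, I.Run z out N := by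
  have hgap : ∀ w ∈ effDom I.h, 0 ≤ I.lam * (I.val w - m) := fun w hw =>
    mul_nonneg hI.lam_pos.le (sub_nonneg.2 (hm w hw))
  obtain ⟨k, hk⟩ := exists_nat_gt (I.lam * (I.val z - m) / I.decrease)
  rw [div_lt_iff₀ hI.decrease_pos] at hk
  induction k generalizing z with
  | zero => exact absurd hk (by simpa using hgap z hz)
  | succ k ih =>
    obtain ⟨j, hj⟩ := hI.exists_isStepOne hz
    rcases le_or_gt ‖z - (I.acg z).x j + (I.acg z).u j‖ (I.lam * I.ρ / 5) with hr | hr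
    · obtain ⟨j', hj'⟩ := hI.exists_isStepThree hz hj hr
      exact ⟨_, _, .last z j j' hj hr hj'⟩
    · push_cast at hk
      obtain ⟨out, N, hrun⟩ := ih (hI.acg_x_mem hz j)
        (by linarith only [hk, hI.val_add_decrease_le hz hj hr])
      exact ⟨out, j + N, .next z j out N hj hr hrun⟩

theorem Regular.run_iterations_mul_decrease_le (hI : I.Regular)
    (hm : ∀ w ∈ effDom I.h, m ≤ I.val w) (hrun : I.Run z out N) (hz : z ∈ effDom I.h) :
    N * I.decrease ≤ I.approxIters * (I.lam * (I.val z - m)) + I.accurateIters * I.decrease := by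
  have hδ := hI.decrease_pos.le
  induction hrun with
  | last z j j' hj hr hj' =>
    have hle : (j' : ℝ) ≤ I.accurateIters := mod_cast hI.isStepThree_le hz hj hr hj'
    have hgap := mul_nonneg hI.lam_pos.le (sub_nonneg.2 (hm z hz))
    exact le_add_of_nonneg_of_le (by positivity) (by gcongr)
  | next z j _ N hj hr _ ih =>
    have hle : (j : ℝ) ≤ I.approxIters := mod_cast hI.isStepOne_le hz hj
    have hdecr := mul_le_mul_of_nonneg_left (hI.val_add_decrease_le hz hj hr)
      I.approxIters.cast_nonneg
    push_cast
    linarith only [mul_le_mul_of_nonneg_right hle hδ, hdecr, ih (hI.acg_x_mem hz j)]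

theorem Regular.val_out_le (hI : I.Regular) (hrun : I.Run z out N) (hz : z ∈ effDom I.h) :
    I.lam * I.val out.z ≤ I.lam * I.val z := by
  induction hrun with
  | last z _ _ _ _ hj' =>
    have hσ := sub_nonneg.2 hI.σ_lt_one.le
    exact (le_add_of_nonneg_right (by positivity)).trans
      (hI.val_add_le_of_isProxApprox hz hj'.1.2.1)
  | next z j _ _ hj hr _ ih =>
    linarith only [ih (hI.acg_x_mem hz j), hI.val_add_decrease_le hz hj hr, hI.decrease_pos]

theorem Regular.run_output_spec (hI : I.Regular) (hrun : I.Run z out N) (hz : z ∈ effDom I.h) :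
    ∃ (zp u : Vec n) (η : ℝ), I.IsProxApprox zp out.z u η ∧
      ‖zp - out.z + u‖ ≤ 3 * (I.lam * I.ρ / 5) ∧ η / I.lam ≤ I.ε := by
  induction hrun with
  | last z j j' hj hr hj' =>
    exact ⟨z, _, _, hj'.1.2.1, hI.norm_acg_residual_le hz hj hr hj'.1.1, hj'.1.2.2⟩
  | next z j _ _ _ _ _ ih => exact ih (hI.acg_x_mem hz j)

theorem Regular.run_out_mem (hI : I.Regular) (hrun : I.Run z out N) (hz : z ∈ effDom I.h) :
    out.z ∈ effDom I.h := by
  obtain ⟨_, _, _, happrox, -⟩ := hI.run_output_spec hrun hz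
  exact (hI.isProxApprox_iff.1 happrox).2.1.1

section Gap

/- The objective gap at the initial point is not controlled by the distance to the solutions, but
after one outer iteration it is: hence the bound `B`. -/
variable {B : ℝ} (hI : I.Regular) (hm : ∀ w ∈ effDom I.h, m ≤ I.val w) (hz : z ∈ effDom I.h)
  (hB : ∀ x u η, I.IsProxApprox z x u η → I.lam * (I.val x - m) ≤ B) (hrun : I.Run z out N)
include hI hz hB hrun

theorem Regular.gap_out_le : I.lam * (I.val out.z - m) ≤ B := by
  cases hrun with
  | last _ _ _ _ _ hj' => exact hB _ _ _ hj'.1.2.1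
  | next _ j _ _ hj _ hrun =>
    linarith only [hB _ _ _ hj.1.2, hI.val_out_le hrun (hI.acg_x_mem hz j)]

include hm

theorem Regular.gap_bound_nonneg : 0 ≤ B :=
  (mul_nonneg hI.lam_pos.le (sub_nonneg.2 (hm _ (hI.run_out_mem hrun hz)))).trans
    (hI.gap_out_le hz hB hrun)

theorem Regular.run_iterations_mul_decrease_le_of_gap :
    N * I.decrease ≤ I.approxIters * B + (I.approxIters + I.accurateIters) * I.decrease := by
  have hδ := hI.decrease_pos.le
  have hB0 := hI.gap_bound_nonneg hm hz hB hrun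
  cases hrun with
  | last _ j _ hj hr hj' =>
    have hle : (N : ℝ) ≤ I.accurateIters := mod_cast hI.isStepThree_le hz hj hr hj'
    exact le_add_of_nonneg_of_le (by positivity)
      (by gcongr; exact le_add_of_nonneg_of_le (by positivity) hle)
  | next _ j _ N hj hr hrun =>
    have hle : (j : ℝ) ≤ I.approxIters := mod_cast hI.isStepOne_le hz hj
    have hgap := mul_le_mul_of_nonneg_left (hB _ _ _ hj.1.2) I.approxIters.cast_nonneg
    push_cast
    linarith only [mul_le_mul_of_nonneg_right hle hδ, hgap,
      hI.run_iterations_mul_decrease_le hm hrun (hI.acg_x_mem hz j)]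

end Gap

theorem Regular.approxIters_le (hI : I.Regular) :
    (I.approxIters : ℝ) ≤ 10 * √(I.curv / I.σ) := by
  have hone : 1 ≤ √(I.curv / I.σ) := Real.one_le_sqrt.2 (hI.one_le_curv.trans hI.curv_le_div_σ)
  have hceil := (Nat.ceil_lt_add_one (by positivity : 0 ≤ 9 * √(I.curv / I.σ))).le
  unfold approxIters
  linarith only [hone, hceil]

theorem Regular.accurateIters_le (hI : I.Regular) :
    (I.accurateIters : ℝ) ≤ √(I.curv / I.σ) * (12 + 4 * Real.log (2 * I.curv)) := by
  have hc := hI.one_le_curv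
  have hsqrt : √I.curv ≤ √(I.curv / I.σ) := Real.sqrt_le_sqrt hI.curv_le_div_σ
  have hone : 1 ≤ √I.curv := Real.one_le_sqrt.2 hc
  have hlog : 0 ≤ Real.log (2 * I.curv) := Real.log_nonneg (by linarith only [hc])
  have hceil := (Nat.ceil_lt_add_one (by positivity : 0 ≤ 4 * √I.curv * Real.log (2 * I.curv))).le
  have hlog_le := mul_le_mul_of_nonneg_right hsqrt hlog
  unfold accurateIters
  push_cast
  refine max_le ?_ (by linarith only [hsqrt, hone, hceil, hlog_le])
  linarith only [hI.approxIters_le, hsqrt, hone,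
    mul_nonneg (Real.sqrt_nonneg (I.curv / I.σ)) hlog]

theorem Regular.run_iterations_le_of_gap (hI : I.Regular) {B : ℝ}
    (hm : ∀ w ∈ effDom I.h, m ≤ I.val w) (hz : z ∈ effDom I.h)
    (hB : ∀ x u η, I.IsProxApprox z x u η → I.lam * (I.val x - m) ≤ B) (hrun : I.Run z out N) :
    N ≤ √(I.curv / I.σ) * (10 * (B / I.decrease) + 22 + 4 * Real.log (2 * I.curv)) := by
  have hδ := hI.decrease_pos
  have hN := hI.run_iterations_mul_decrease_le_of_gap hm hz hB hrun
  have hBδ : 0 ≤ B / I.decrease := div_nonneg (hI.gap_bound_nonneg hm hz hB hrun) hδ.le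
  calc (N : ℝ) ≤ I.approxIters * (B / I.decrease) + (I.approxIters + I.accurateIters) := by
        refine le_of_mul_le_mul_right ?_ hδ
        rwa [add_mul, mul_assoc, div_mul_cancel₀ _ hδ.ne']
    _ ≤ 10 * √(I.curv / I.σ) * (B / I.decrease) + (10 * √(I.curv / I.σ)
          + √(I.curv / I.σ) * (12 + 4 * Real.log (2 * I.curv))) := by
        gcongr
        exacts [hI.approxIters_le, hI.approxIters_le, hI.accurateIters_le]
    _ = _ := by ring

end Runs

end AIPPInput

/-! ### The composite gradient step -/

theorem affApprox_sub_affApprox {n : ℕ} (ψ : Vec n → ℝ) (u v w : Vec n) :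
    affApprox ψ u w - affApprox ψ v w = ⟪gradient ψ w, u - v⟫ := by
  rw [affApprox, affApprox, add_sub_add_left_eq_sub, ← inner_sub_right, sub_sub_sub_cancel_right]

namespace AIPPInput

variable {n : ℕ} {I : AIPPInput n} {z : Vec n}

theorem Regular.M_pos (hI : I.Regular) : 0 < I.M :=
  (mul_pos_iff_of_pos_left hI.lam_pos).1 (one_half_pos.trans_le hI.half_le_lam_mul_M)

theorem Regular.M_add_inv_lam_pos (hI : I.Regular) : 0 < I.M + I.lam⁻¹ :=
  add_pos hI.M_pos (inv_pos.2 hI.lam_pos)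

theorem Regular.zg_spec (hI : I.Regular) (z : Vec n) :
    I.zg z ∈ effDom I.h ∧ ∀ u ∈ effDom I.h,
      (I.h (I.zg z)).toReal + affApprox I.g (I.zg z) z
          + (I.M + I.lam⁻¹) / 2 * ‖I.zg z - z‖ ^ 2 + (I.M + I.lam⁻¹) / 2 * ‖u - I.zg z‖ ^ 2
        ≤ (I.h u).toReal + affApprox I.g u z + (I.M + I.lam⁻¹) / 2 * ‖u - z‖ ^ 2 := by
  have hconv := hI.conv.convexOn
  have haff := (convexOn_affApprox I.g z).subset (Set.subset_univ _) hconv.1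
  have hcont : Continuous fun u => affApprox I.g u z + (I.M + I.lam⁻¹) / 2 * ‖u - z‖ ^ 2 :=
    (continuous_affApprox _ _).add (by fun_prop)
  obtain ⟨hmem, hgrowth⟩ := hI.conv.argmin_add_coe_spec (y := I.zg z) le_rfl
    (by rw [zero_add]; exact hI.M_add_inv_lam_pos) (strongConvexOn_zero.2 hconv) hcont
    (strongConvexOn_add (strongConvexOn_zero.2 haff)
      (strongConvexOn_half_mul_norm_sub_sq hconv.1 (I.M + I.lam⁻¹) z))
    (by simp only [zg, EReal.coe_add, add_left_comm (I.h _), add_assoc])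
  refine ⟨hmem, fun u hu => ?_⟩
  linarith only [hgrowth u hu]

theorem Regular.val_zg_add_le (hI : I.Regular) (hz : z ∈ effDom I.h) :
    I.val (I.zg z) + (I.M / 2 + I.lam⁻¹) * ‖I.zg z - z‖ ^ 2 ≤ I.val z := by
  obtain ⟨hmem, hgrowth⟩ := hI.zg_spec z
  have hz_growth := hgrowth z hz
  have hself : affApprox I.g z z = I.g z := by
    rw [affApprox, sub_self, inner_zero_right, add_zero]
  rw [hself, sub_self, norm_zero, norm_sub_rev z] at hz_growth
  unfold val
  linarith only [hz_growth, hI.upper _ hmem z hz]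

theorem Regular.smul_sub_sub_gradient_mem_subdiff (hI : I.Regular) (z : Vec n) :
    (I.M + I.lam⁻¹) • (z - I.zg z) - gradient I.g z ∈ subdiff I.h (I.zg z) := by
  obtain ⟨hmem, hgrowth⟩ := hI.zg_spec z
  refine (mem_epsSubdiff_iff (φ := fun x => (I.h x).toReal)
    fun x hx => (hI.conv.coe_toReal hx).symm).2 ⟨hmem, fun u hu => ?_⟩
  have hstep := hgrowth u hu
  have haff := affApprox_sub_affApprox I.g u (I.zg z) z
  rw [norm_sub_sq_eq_add_inner u z (I.zg z), ← neg_sub z (I.zg z), inner_neg_left] at hstep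
  rw [inner_sub_left, real_inner_smul_left]
  linarith only [hstep, haff]

theorem Regular.mul_sq_norm_zg_sub_le (hI : I.Regular) {zp u : Vec n} {η : ℝ}
    (h : I.IsProxApprox zp z u η) :
    I.lam * ((I.M + I.lam⁻¹) / 2 * ‖I.zg z - z‖ ^ 2) ≤ ‖zp - z + u‖ * ‖I.zg z - z‖ + η := by
  obtain ⟨-, ⟨hz, hsub⟩, -⟩ := hI.isProxApprox_iff.1 h
  have hzg_sub := hsub _ (hI.zg_spec z).1
  have hdescent := mul_le_mul_of_nonneg_left (hI.val_zg_add_le hz) hI.lam_pos.le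
  have hsq := norm_sub_sq_eq_add_inner (I.zg z) zp z
  have hcs : ⟪z - zp, I.zg z - z⟫ - ⟪u, I.zg z - z⟫ ≤ ‖zp - z + u‖ * ‖I.zg z - z‖ := by
    rw [← inner_sub_left, ← norm_neg (zp - z + u), neg_add', neg_sub]
    exact real_inner_le_norm _ _
  linear_combination hzg_sub + hdescent + hcs + 1 / 2 * hsq
    - 1 / 2 * ‖I.zg z - z‖ ^ 2 * mul_inv_cancel₀ hI.lam_pos.ne'

theorem Regular.M_add_inv_lam_mul_norm_zg_sub_le (hI : I.Regular) {zp u : Vec n} {η : ℝ}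
    (h : I.IsProxApprox zp z u η) (hres : ‖zp - z + u‖ ≤ 3 * (I.lam * I.ρ / 5))
    (hη : η / I.lam ≤ I.ε) (hε : 2 * (I.M + I.lam⁻¹) * I.ε ≤ I.ρ ^ 2) :
    (I.M + I.lam⁻¹) * ‖I.zg z - z‖ ≤ 2 * I.ρ := by
  have hK := hI.M_add_inv_lam_pos
  rw [div_le_iff₀ hI.lam_pos] at hη
  have hstep : (I.M + I.lam⁻¹) / 2 * ‖I.zg z - z‖ ^ 2 ≤ 3 / 5 * I.ρ * ‖I.zg z - z‖ + I.ε :=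
    le_of_mul_le_mul_left (by linarith only [hI.mul_sq_norm_zg_sub_le h, hη,
      mul_le_mul_of_nonneg_right hres (norm_nonneg (I.zg z - z))]) hI.lam_pos
  have hquad : ((I.M + I.lam⁻¹) * ‖I.zg z - z‖) ^ 2
      ≤ 6 / 5 * I.ρ * ((I.M + I.lam⁻¹) * ‖I.zg z - z‖) + I.ρ ^ 2 := by
    linarith only [mul_le_mul_of_nonneg_left hstep (by positivity : 0 ≤ 2 * (I.M + I.lam⁻¹)), hε]
  by_contra! hlt
  nlinarith only [hquad, hlt, hI.ρ_pos]

theorem norm_vg_le (I : AIPPInput n) {κ : ℝ} (hK : 0 ≤ I.M + I.lam⁻¹)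
    (hκ : ‖gradient I.g (I.zg z) - gradient I.g z‖ ≤ κ * ‖I.zg z - z‖) :
    ‖I.vg z‖ ≤ (I.M + I.lam⁻¹ + κ) * ‖I.zg z - z‖ := by
  rw [vg, add_sub_assoc, add_mul]
  refine (norm_add_le _ _).trans (add_le_add ?_ hκ)
  rw [norm_smul, Real.norm_of_nonneg hK, norm_sub_rev]

end AIPPInput

/-! ### The penalized problems -/

namespace Problem

variable {n l : ℕ} {P : Problem n l} {σ ρ η c : ℝ} {z0 : Vec n}

theorem hasGradientAt_g (P : Problem n l) {w : Vec n} (hw : DifferentiableAt ℝ P.f w) (c : ℝ) :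
    HasGradientAt (P.g c)
      (gradient P.f w + ContinuousLinearMap.adjoint P.A (c • (P.A w - P.b))) w := by
  have hpenalty := ((P.A.hasFDerivAt (x := w)).sub_const P.b).norm_sq.const_mul (c / 2)
  rw [hasGradientAt_iff_hasFDerivAt]
  refine (hw.hasGradientAt.hasFDerivAt.add hpenalty).congr_fderiv ?_
  ext v
  simp only [add_apply, smul_apply, map_add, ContinuousLinearMap.comp_apply, coe_innerSL_apply,
    InnerProductSpace.toDual_apply_apply, ContinuousLinearMap.adjoint_inner_left,
    real_inner_smul_left, nsmul_eq_mul, Nat.cast_ofNat, smul_eq_mul]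
  ring

theorem g_sub_affApprox (P : Problem n l) {w : Vec n} (hw : DifferentiableAt ℝ P.f w)
    (c : ℝ) (u : Vec n) :
    P.g c u - affApprox (P.g c) u w
      = P.f u - affApprox P.f u w + c / 2 * ‖P.A (u - w)‖ ^ 2 := by
  rw [affApprox, affApprox, (P.hasGradientAt_g hw c).gradient, inner_add_left,
    ContinuousLinearMap.adjoint_inner_left, real_inner_smul_left, map_sub, g, g]
  linear_combination c / 2 * norm_sub_sq_eq_add_inner (P.A u) P.b (P.A w)

/-- The penalized objective `φ_c` as a real number, meaningful on the effective domain of `h`. -/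
noncomputable def val (P : Problem n l) (c : ℝ) (w : Vec n) : ℝ := P.g c w + (P.h w).toReal

theorem val_eq_add (P : Problem n l) (c c' : ℝ) (w : Vec n) :
    P.val c w = P.val c' w + (c - c') / 2 * ‖P.A w - P.b‖ ^ 2 := by
  unfold val g
  ring

theorem val_eq_of_feasible (P : Problem n l) (c c' : ℝ) {w : Vec n} (hw : w ∈ P.feasible) :
    P.val c w = P.val c' w := by
  rw [P.val_eq_add c c', hw.2, sub_self, norm_zero, zero_pow two_ne_zero, mul_zero, add_zero]

namespace Assumptions

theorem lam_pos (hP : P.Assumptions) : 0 < P.lam :=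
  one_div_pos.2 (mul_pos two_pos hP.mf_pos)

theorem Lf_pos (hP : P.Assumptions) : 0 < P.Lf := hP.mf_pos.trans_le hP.mf_le_Lf

theorem g_le_affApprox_add (hP : P.Assumptions) (hc : 0 ≤ c) {u z : Vec n}
    (hu : u ∈ effDom P.h) (hz : z ∈ effDom P.h) :
    P.g c u ≤ affApprox (P.g c) u z + (P.Lf + c * ‖P.A‖ ^ 2) / 2 * ‖u - z‖ ^ 2 := by
  have hf : P.f u ≤ affApprox P.f u z + P.Lf / 2 * ‖u - z‖ ^ 2 :=
    le_add_inner_gradient_add_of_lipschitz hP.h_conv.convexOn.1 hP.f_diff (hP.f_lip z hz) hz hu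
  have hA : ‖P.A (u - z)‖ ^ 2 ≤ ‖P.A‖ ^ 2 * ‖u - z‖ ^ 2 := by
    rw [← mul_pow]
    exact pow_le_pow_left₀ (norm_nonneg _) (P.A.le_opNorm _) 2
  linarith only [P.g_sub_affApprox (hP.f_diff z hz) c u, hf, mul_le_mul_of_nonneg_left hA hc]

theorem affApprox_sub_le_g (hP : P.Assumptions) (hc : 0 ≤ c) {u z : Vec n}
    (hu : u ∈ effDom P.h) (hz : z ∈ effDom P.h) :
    affApprox (P.g c) u z - P.mf / 2 * ‖u - z‖ ^ 2 ≤ P.g c u := by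
  have hpenalty : 0 ≤ c / 2 * ‖P.A (u - z)‖ ^ 2 := by positivity
  linarith only [P.g_sub_affApprox (hP.f_diff z hz) c u, hP.f_lower u hu z hz, hpenalty]

theorem norm_gradient_g_sub_le (hP : P.Assumptions) (hc : 0 ≤ c) {u z : Vec n}
    (hu : u ∈ effDom P.h) (hz : z ∈ effDom P.h) :
    ‖gradient (P.g c) u - gradient (P.g c) z‖ ≤ (P.Lf + c * ‖P.A‖ ^ 2) * ‖u - z‖ := by
  have hpenalty : ‖ContinuousLinearMap.adjoint P.A (c • P.A (u - z))‖
      ≤ c * ‖P.A‖ ^ 2 * ‖u - z‖ :=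
    calc ‖ContinuousLinearMap.adjoint P.A (c • P.A (u - z))‖
        ≤ ‖ContinuousLinearMap.adjoint P.A‖ * ‖c • P.A (u - z)‖ :=
          ContinuousLinearMap.le_opNorm _ _
      _ ≤ ‖P.A‖ * (c * (‖P.A‖ * ‖u - z‖)) := by
          rw [LinearIsometryEquiv.norm_map, norm_smul, Real.norm_of_nonneg hc]
          gcongr
          exact P.A.le_opNorm _
      _ = c * ‖P.A‖ ^ 2 * ‖u - z‖ := by ring
  rw [(P.hasGradientAt_g (hP.f_diff u hu) c).gradient,
    (P.hasGradientAt_g (hP.f_diff z hz) c).gradient, add_sub_add_comm, ← map_sub, ← smul_sub,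
    sub_sub_sub_cancel_right, ← map_sub, add_mul]
  exact (norm_add_le _ _).trans (add_le_add (hP.f_lip z hz u hu) hpenalty)

theorem aipp_tolerance (hP : P.Assumptions) (hc : 0 ≤ c) (ρ : ℝ) :
    9 * P.lam * (ρ / 4) ^ 2 ≤ 50 * (P.lam * (P.Lf + c * ‖P.A‖ ^ 2) + 1 / 2)
      * (ρ ^ 2 / (32 * (P.Lf + c * ‖P.A‖ ^ 2 + 2 * P.mf))) := by
  have hm := hP.mf_pos
  have hmM : P.mf ≤ P.Lf + c * ‖P.A‖ ^ 2 :=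
    hP.mf_le_Lf.trans (le_add_of_nonneg_right (by positivity))
  set M := P.Lf + c * ‖P.A‖ ^ 2
  have hM : 0 < M := hm.trans_le hmM
  calc 9 * P.lam * (ρ / 4) ^ 2 = 9 / (32 * P.mf) * ρ ^ 2 := by
        unfold Problem.lam
        ring
    _ ≤ 25 * (M + P.mf) / (32 * P.mf * (M + 2 * P.mf)) * ρ ^ 2 := by
        gcongr ?_ * ρ ^ 2
        rw [div_le_div_iff₀ (by positivity) (by positivity)]
        nlinarith only [mul_pos hm hm, mul_pos hm hM]
    _ = 50 * (P.lam * M + 1 / 2) * (ρ ^ 2 / (32 * (M + 2 * P.mf))) := by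
        unfold Problem.lam
        field_simp
        ring

theorem aipp_regular (hP : P.Assumptions) (hσ0 : 0 < σ) (hσ1 : σ < 1) (hρ : 0 < ρ) (hc : 0 ≤ c) :
    (P.aipp σ ρ c).Regular where
  conv := hP.h_conv
  lam_pos := hP.lam_pos
  diff z hz := (P.hasGradientAt_g (hP.f_diff z hz) c).differentiableAt
  lower u hu z hz := by
    have hscaled := mul_le_mul_of_nonneg_left (hP.affApprox_sub_le_g hc hu hz) hP.lam_pos.le
    have hlam : P.lam * P.mf = 1 / 2 := by
      have := hP.mf_pos.ne'
      unfold Problem.lam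
      field_simp
    simp only [aipp]
    linear_combination hscaled + 1 / 2 * ‖u - z‖ ^ 2 * hlam
  upper u hu z hz := hP.g_le_affApprox_add hc hu hz
  half_le_lam_mul_M := by
    have hm := hP.mf_pos
    have hpenalty : 0 ≤ c * ‖P.A‖ ^ 2 := by positivity
    simp only [aipp, Problem.lam]
    rw [div_mul_eq_mul_div, one_mul, div_le_div_iff₀ two_pos (by positivity)]
    linarith only [hP.mf_le_Lf, hpenalty]
  σ_pos := hσ0
  σ_lt_one := hσ1
  ρ_pos := div_pos hρ four_pos
  tolerance := hP.aipp_tolerance hc ρ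

theorem φ_eq_coe_val (hP : P.Assumptions) (c : ℝ) {w : Vec n} (hw : w ∈ effDom P.h) :
    P.φ c w = ((P.val c w : ℝ) : EReal) := by
  rw [φ, ← hP.h_conv.coe_toReal hw, ← EReal.coe_add, ← EReal.coe_add, val, g, add_right_comm]

theorem φstar_le_val (hP : P.Assumptions) (hc : P.chat ≤ c) {w : Vec n} (hw : w ∈ effDom P.h) :
    (P.φstar P.chat).toReal ≤ P.val c w := by
  have hle : P.φstar P.chat ≤ ((P.val P.chat w : ℝ) : EReal) :=
    (iInf_le _ w).trans_eq (hP.φ_eq_coe_val P.chat hw)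
  rw [P.val_eq_add c P.chat]
  refine le_add_of_le_of_nonneg ?_ (mul_nonneg (by linarith only [hc]) (sq_nonneg _))
  simpa only [EReal.toReal_coe] using
    EReal.toReal_le_toReal hle hP.bdd_below.ne' (EReal.coe_ne_top _)

theorem le_R (hP : P.Assumptions) {B : ℝ} (hB : ∀ u ∈ P.feasible,
      B ≤ 1 / 2 * ‖z0 - u‖ ^ 2 + (1 - σ) * P.lam * (P.val P.chat u - (P.φstar P.chat).toReal)) :
    B ≤ P.R σ z0 P.chat P.lam := by
  have : Nonempty P.feasible := hP.feasible_nonempty.to_subtype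
  refine le_ciInf fun u => ?_
  rw [hP.φ_eq_coe_val P.chat u.2.1, EReal.toReal_coe]
  exact hB u u.2

theorem R_nonneg (hP : P.Assumptions) (hσ1 : σ < 1) (z0 : Vec n) :
    0 ≤ P.R σ z0 P.chat P.lam := by
  refine hP.le_R fun u hu => ?_
  have hgap := sub_nonneg.2 (hP.φstar_le_val le_rfl hu.1)
  have hlam := hP.lam_pos
  positivity

end Assumptions

/-! ### A single AIPP call of the QP-AIPP method -/

section Call

variable {o : AIPPOutput n} {N : ℕ} (hP : P.Assumptions) (hI : (P.aipp σ ρ c).Regular)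
include hP hI

/- A feasible point does not see the penalty, which is why this bound is uniform in `c`. -/
theorem Assumptions.gap_le_of_isProxApprox {x u : Vec n} {η : ℝ}
    (h : (P.aipp σ ρ c).IsProxApprox z0 x u η) :
    P.lam * (P.val c x - (P.φstar P.chat).toReal) ≤ P.R σ z0 P.chat P.lam / (1 - σ) := by
  have hσ : 0 < 1 - σ := sub_pos.2 hI.σ_lt_one
  rw [le_div_iff₀ hσ]
  refine hP.le_R fun w hw => ?_
  have hval : (1 - σ) * (P.lam * P.val c x)
      ≤ (1 - σ) * (P.lam * P.val c w) + 1 / 2 * ‖z0 - w‖ ^ 2 :=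
    hI.one_sub_σ_mul_val_le_of_isProxApprox hw.1 h
  rw [P.val_eq_of_feasible c P.chat hw] at hval
  linarith only [hval]

theorem Assumptions.le_T_of_infeasible (hη : 0 < η) (hc : P.chat ≤ c) (hz0 : z0 ∈ effDom P.h)
    (hrun : (P.aipp σ ρ c).Run z0 o N) (hfail : η < ‖P.A ((P.aipp σ ρ c).zg o.z) - P.b‖) :
    c ≤ P.T σ z0 η := by
  have hσ : 0 < 1 - σ := sub_pos.2 hI.σ_lt_one
  have hlam := hP.lam_pos
  have hgap : P.lam * (P.val c o.z - (P.φstar P.chat).toReal) ≤ P.R σ z0 P.chat P.lam / (1 - σ) :=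
    hI.gap_out_le hz0 (fun _ _ _ => hP.gap_le_of_isProxApprox hI) hrun
  obtain ⟨hzg, -⟩ := hI.zg_spec o.z
  have hdescent := hI.val_zg_add_le (hI.run_out_mem hrun hz0)
  set zg := (P.aipp σ ρ c).zg o.z
  have hval : P.val c zg ≤ P.val c o.z := (le_add_of_nonneg_right (mul_nonneg
    (add_pos (half_pos hI.M_pos) (inv_pos.2 hI.lam_pos)).le (sq_nonneg _))).trans hdescent
  have hpenalty : (c - P.chat) / 2 * η ^ 2 ≤ (c - P.chat) / 2 * ‖P.A zg - P.b‖ ^ 2 := by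
    have := sub_nonneg.2 hc
    gcongr
  have hR : P.lam * ((c - P.chat) / 2 * η ^ 2) ≤ P.R σ z0 P.chat P.lam / (1 - σ) := by
    refine le_trans (mul_le_mul_of_nonneg_left ?_ hlam.le) hgap
    linarith only [hval, hpenalty, hP.φstar_le_val le_rfl hzg, P.val_eq_add c P.chat zg]
  rw [le_div_iff₀ hσ] at hR
  rw [T, ← sub_le_iff_le_add, le_div_iff₀ (by positivity)]
  linarith only [hR]

theorem Assumptions.norm_aipp_vg_le (hc : 0 ≤ c) (hz0 : z0 ∈ effDom P.h)
    (hrun : (P.aipp σ ρ c).Run z0 o N) : ‖(P.aipp σ ρ c).vg o.z‖ ≤ ρ := by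
  obtain ⟨_, _, _, happrox, hres, hη⟩ := hI.run_output_spec hrun hz0
  have hm := hP.mf_pos
  have hK : (P.aipp σ ρ c).M + (P.aipp σ ρ c).lam⁻¹ = P.Lf + c * ‖P.A‖ ^ 2 + 2 * P.mf := by
    simp only [aipp, Problem.lam, one_div, inv_inv]
  have hK0 := hI.M_add_inv_lam_pos
  have hvg := (P.aipp σ ρ c).norm_vg_le hK0.le
    (hP.norm_gradient_g_sub_le hc (hI.zg_spec o.z).1 (hI.run_out_mem hrun hz0))
  rw [hK] at hK0 hvg
  have hε : 2 * (P.Lf + c * ‖P.A‖ ^ 2 + 2 * P.mf)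
      * (ρ ^ 2 / (32 * (P.Lf + c * ‖P.A‖ ^ 2 + 2 * P.mf))) ≤ (ρ / 4) ^ 2 := by
    refine le_of_eq ?_
    field_simp
    ring
  have hdist : (P.Lf + c * ‖P.A‖ ^ 2 + 2 * P.mf) * ‖(P.aipp σ ρ c).zg o.z - o.z‖ ≤ 2 * (ρ / 4) :=
    hK ▸ hI.M_add_inv_lam_mul_norm_zg_sub_le happrox hres hη (hK ▸ hε)
  have hslack := mul_nonneg hm.le (norm_nonneg ((P.aipp σ ρ c).zg o.z - o.z))
  linarith only [hvg, hdist, hslack]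

theorem Assumptions.isApproxSolution_of_aipp_run (hc : 0 ≤ c) (hz0 : z0 ∈ effDom P.h)
    (hrun : (P.aipp σ ρ c).Run z0 o N) (hfeas : ‖P.A ((P.aipp σ ρ c).zg o.z) - P.b‖ ≤ η) :
    P.IsApproxSolution ρ η
      { z := (P.aipp σ ρ c).zg o.z
        v := (P.aipp σ ρ c).vg o.z
        p := c • (P.A ((P.aipp σ ρ c).zg o.z) - P.b) } := by
  have hgrad : gradient (P.aipp σ ρ c).g ((P.aipp σ ρ c).zg o.z) = _ :=
    (P.hasGradientAt_g (hP.f_diff _ (hI.zg_spec o.z).1) c).gradient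
  refine ⟨⟨_, hI.smul_sub_sub_gradient_mem_subdiff o.z, ?_⟩,
    hP.norm_aipp_vg_le hI hc hz0 hrun, hfeas⟩
  dsimp only
  rw [AIPPInput.vg, hgrad]
  abel

end Call

end Problem

/-! ### The complexity of the QP-AIPP method -/

theorem one_le_logOnePlus (t : ℝ) : 1 ≤ logOnePlus t := le_max_right _ _

theorem log_two_mul_le_logOnePlus {x t : ℝ} (hx : 0 < x) (hxt : x ≤ 3 * t) :
    Real.log (2 * x) ≤ 4 * logOnePlus t := by
  have ht : 0 < t := by linarith only [hx, hxt]
  have hlog8 : Real.log 8 = 3 * Real.log 2 := by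
    rw [show (8 : ℝ) = 2 ^ 3 by norm_num, Real.log_pow, Nat.cast_ofNat]
  calc Real.log (2 * x) ≤ Real.log (8 * t) :=
        Real.log_le_log (by positivity) (by linarith only [hxt, ht])
    _ = 3 * Real.log 2 + Real.log t := by rw [Real.log_mul (by norm_num) ht.ne', hlog8]
    _ ≤ 3 * 1 + logOnePlus t := by
        gcongr
        · exact Real.log_two_lt_d9.le.trans (by norm_num)
        · exact le_max_left _ _
    _ ≤ 4 * logOnePlus t := by linarith only [one_le_logOnePlus t]

namespace Problem

variable {n l : ℕ} {P : Problem n l} {σ ρ η c : ℝ} {z0 : Vec n}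

/-- The ratio `c ‖A‖² / m_f`, the condition number of the penalty term. The cost of an AIPP call
grows like its square root. -/
noncomputable def condNumber (P : Problem n l) (c : ℝ) : ℝ := c * ‖P.A‖ ^ 2 / P.mf

/-- The range of penalty parameters in which the AIPP calls of the QP-AIPP method take place. Its
upper end is `2 Θ` because `c` is only doubled after a call that fails the feasibility test, which
forces `c ≤ T`. -/
structure IsPenalty (P : Problem n l) (σ : ℝ) (z0 : Vec n) (η c : ℝ) : Prop where
  chat_le : P.chat ≤ c
  Lf_le : P.Lf ≤ c * ‖P.A‖ ^ 2
  condNumber_le : P.condNumber c ≤ 2 * P.Θ σ z0 η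

/-- The constant of the complexity bound of a single AIPP call. -/
noncomputable def callConst (σ : ℝ) : ℝ := 32000 * √(3 / 2 / σ) / (1 - σ) ^ 2

/-- The bracket `m_f² R / ρ² + log₁⁺ Θ` of the complexity bound. -/
noncomputable def bracket (P : Problem n l) (σ ρ η : ℝ) (z0 : Vec n) : ℝ :=
  P.mf ^ 2 * P.R σ z0 P.chat P.lam / ρ ^ 2 + logOnePlus (P.Θ σ z0 η)

theorem callConst_pos (hσ0 : 0 < σ) (hσ1 : σ < 1) : 0 < callConst σ := by
  have := sub_pos.2 hσ1
  unfold callConst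
  positivity

theorem condNumber_two_mul (P : Problem n l) (c : ℝ) :
    P.condNumber (2 * c) = 2 * P.condNumber c := by
  unfold condNumber
  ring

theorem Θ_eq_add_condNumber (P : Problem n l) (σ : ℝ) (z0 : Vec n) (η : ℝ) :
    P.Θ σ z0 η = P.Lf / P.mf + P.condNumber (P.T σ z0 η) :=
  add_div _ _ _

namespace Assumptions

theorem condNumber_le_condNumber (hP : P.Assumptions) {c' : ℝ} (hcc' : c ≤ c') :
    P.condNumber c ≤ P.condNumber c' := by
  have := hP.mf_pos
  unfold condNumber
  gcongr

theorem chat_le_T (hP : P.Assumptions) (hσ1 : σ < 1) (z0 : Vec n) (η : ℝ) :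
    P.chat ≤ P.T σ z0 η := by
  have hR := hP.R_nonneg hσ1 z0
  have hlam := hP.lam_pos
  exact le_add_of_nonneg_left (by positivity)

theorem one_le_Θ (hP : P.Assumptions) (hσ1 : σ < 1) (z0 : Vec n) (η : ℝ) :
    1 ≤ P.Θ σ z0 η := by
  have hT := hP.chat_nonneg.trans (hP.chat_le_T hσ1 z0 η)
  rw [Problem.Θ, le_div_iff₀ hP.mf_pos, one_mul]
  exact hP.mf_le_Lf.trans (le_add_of_nonneg_right (by positivity))

theorem one_le_bracket (hP : P.Assumptions) (hσ1 : σ < 1) (ρ η : ℝ) (z0 : Vec n) :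
    1 ≤ P.bracket σ ρ η z0 := by
  have hR := hP.R_nonneg hσ1 z0
  exact (one_le_logOnePlus _).trans (le_add_of_nonneg_left (by positivity))

theorem isPenalty_initial (hP : P.Assumptions) (hσ1 : σ < 1) (z0 : Vec n) (η : ℝ) :
    P.IsPenalty σ z0 η (P.chat + P.Lf / ‖P.A‖ ^ 2) := by
  have hA : 0 < ‖P.A‖ := norm_pos_iff.2 hP.A_ne_zero
  have hc := hP.chat_nonneg
  have hLf := hP.Lf_pos
  have hmul : (P.chat + P.Lf / ‖P.A‖ ^ 2) * ‖P.A‖ ^ 2 = P.chat * ‖P.A‖ ^ 2 + P.Lf := by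
    field_simp
  refine ⟨le_add_of_nonneg_right (by positivity), ?_, ?_⟩
  · rw [hmul]
    exact le_add_of_nonneg_left (by positivity)
  · have hcond : P.condNumber (P.chat + P.Lf / ‖P.A‖ ^ 2) ≤ P.Θ σ z0 η := by
      rw [condNumber, hmul, add_comm, add_div, P.Θ_eq_add_condNumber]
      gcongr
      exact hP.condNumber_le_condNumber (hP.chat_le_T hσ1 z0 η)
    linarith only [hcond, hP.one_le_Θ hσ1 z0 η]

theorem isPenalty_two_mul (hP : P.Assumptions) (hc : P.IsPenalty σ z0 η c)
    (hcT : c ≤ P.T σ z0 η) : P.IsPenalty σ z0 η (2 * c) := by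
  have hc0 := hP.chat_nonneg.trans hc.chat_le
  refine ⟨by linarith only [hc.chat_le, hc0], ?_, ?_⟩
  · linarith only [hc.Lf_le, hP.Lf_pos]
  · rw [P.condNumber_two_mul, P.Θ_eq_add_condNumber]
    have hL := div_pos hP.Lf_pos hP.mf_pos
    linarith only [hP.condNumber_le_condNumber hcT, hL]

theorem one_le_condNumber (hP : P.Assumptions) (hc : P.IsPenalty σ z0 η c) :
    1 ≤ P.condNumber c := by
  rw [condNumber, one_le_div hP.mf_pos]
  exact hP.mf_le_Lf.trans hc.Lf_le

theorem curv_aipp_le (hP : P.Assumptions) (ρ : ℝ) (hc : P.IsPenalty σ z0 η c) :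
    (P.aipp σ ρ c).curv ≤ 3 / 2 * P.condNumber c := by
  have hm := hP.mf_pos
  calc (P.aipp σ ρ c).curv = (P.Lf / P.mf + P.condNumber c + 1) / 2 := by
        simp only [AIPPInput.curv, aipp, Problem.lam, condNumber]
        field_simp
    _ ≤ (P.condNumber c + P.condNumber c + P.condNumber c) / 2 := by
        gcongr
        · exact div_le_div_of_nonneg_right hc.Lf_le hm.le
        · exact hP.one_le_condNumber hc
    _ = 3 / 2 * P.condNumber c := by ring

theorem decrease_aipp (P : Problem n l) (σ ρ c : ℝ) :
    (P.aipp σ ρ c).decrease = (1 - σ) * ρ ^ 2 / (3200 * P.mf ^ 2) := by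
  simp only [AIPPInput.decrease, aipp, Problem.lam]
  ring

theorem div_decrease_aipp (hP : P.Assumptions) (hσ1 : σ < 1) (hρ : 0 < ρ) (c r : ℝ) :
    r / (1 - σ) / (P.aipp σ ρ c).decrease = 3200 / (1 - σ) ^ 2 * (P.mf ^ 2 * r / ρ ^ 2) := by
  have := hP.mf_pos
  have := sub_pos.2 hσ1
  rw [decrease_aipp]
  field_simp

theorem sqrt_curv_aipp_div_le (hP : P.Assumptions) (hσ0 : 0 < σ) (ρ : ℝ)
    (hc : P.IsPenalty σ z0 η c) :
    √((P.aipp σ ρ c).curv / σ) ≤ √(3 / 2 / σ) * √(P.condNumber c) := by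
  rw [← Real.sqrt_mul (by positivity), div_mul_eq_mul_div]
  gcongr
  exact hP.curv_aipp_le ρ hc

theorem aipp_run_iterations_le (hP : P.Assumptions) (hσ0 : 0 < σ) (hσ1 : σ < 1) (hρ : 0 < ρ)
    (hz0 : z0 ∈ effDom P.h) (hc : P.IsPenalty σ z0 η c) {o : AIPPOutput n} {N : ℕ}
    (hrun : (P.aipp σ ρ c).Run z0 o N) :
    (N : ℝ) ≤ callConst σ * P.bracket σ ρ η z0 * √(P.condNumber c) := by
  have hI := hP.aipp_regular hσ0 hσ1 hρ (hP.chat_nonneg.trans hc.chat_le)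
  have hσ := sub_pos.2 hσ1
  have hN := hI.run_iterations_le_of_gap (fun _ => hP.φstar_le_val hc.chat_le) hz0
    (fun _ _ _ => hP.gap_le_of_isProxApprox hI) hrun
  rw [hP.div_decrease_aipp hσ1 hρ] at hN
  have hlog : Real.log (2 * (P.aipp σ ρ c).curv) ≤ 4 * logOnePlus (P.Θ σ z0 η) :=
    log_two_mul_le_logOnePlus (one_pos.trans_le hI.one_le_curv)
      (by linarith only [hP.curv_aipp_le ρ hc, hc.condNumber_le])
  have hbracket := hP.one_le_bracket hσ1 ρ η z0
  have hΛ := one_le_logOnePlus (P.Θ σ z0 η)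
  set X := P.mf ^ 2 * P.R σ z0 P.chat P.lam / ρ ^ 2
  set Λ := logOnePlus (P.Θ σ z0 η)
  have hinv : 1 ≤ 1 / (1 - σ) ^ 2 :=
    (one_le_div (by positivity)).2 (pow_le_one₀ hσ.le (by linarith only [hσ0]))
  have hfactor : 10 * (3200 / (1 - σ) ^ 2 * X) + 22 + 4 * Real.log (2 * (P.aipp σ ρ c).curv)
      ≤ 32000 / (1 - σ) ^ 2 * P.bracket σ ρ η z0 := by
    have hΛinv : Λ ≤ 1 / (1 - σ) ^ 2 * Λ :=
      le_mul_of_one_le_left (by linarith only [hΛ]) hinv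
    calc _ ≤ 10 * (3200 / (1 - σ) ^ 2 * X) + 32000 * (1 / (1 - σ) ^ 2 * Λ) := by
          linarith only [hlog, hΛ, hΛinv]
      _ = 32000 / (1 - σ) ^ 2 * P.bracket σ ρ η z0 := by
          unfold bracket
          ring
  calc (N : ℝ) ≤ √((P.aipp σ ρ c).curv / σ) * _ := hN
    _ ≤ √((P.aipp σ ρ c).curv / σ) * (32000 / (1 - σ) ^ 2 * P.bracket σ ρ η z0) := by gcongr
    _ ≤ √(3 / 2 / σ) * √(P.condNumber c) * (32000 / (1 - σ) ^ 2 * P.bracket σ ρ η z0) := by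
        gcongr
        exact hP.sqrt_curv_aipp_div_le hσ0 ρ hc
    _ = callConst σ * P.bracket σ ρ η z0 * √(P.condNumber c) := by
        unfold callConst
        ring

theorem exists_runFrom (hP : P.Assumptions) (hσ0 : 0 < σ) (hσ1 : σ < 1) (hρ : 0 < ρ) (hη : 0 < η)
    (hz0 : z0 ∈ effDom P.h) (hc : P.IsPenalty σ z0 η c) :
    ∃ out N, P.RunFrom σ ρ η z0 c out N := by
  obtain ⟨k, hk⟩ := pow_unbounded_of_one_lt (2 * P.Θ σ z0 η) one_lt_two
  replace hk : 2 * P.Θ σ z0 η < 2 ^ k * P.condNumber c :=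
    hk.trans_le (le_mul_of_one_le_right (by positivity) (hP.one_le_condNumber hc))
  induction k generalizing c with
  | zero => exact absurd hc.condNumber_le (by simpa only [pow_zero, one_mul, not_le] using hk)
  | succ k ih =>
    have hI := hP.aipp_regular hσ0 hσ1 hρ (hP.chat_nonneg.trans hc.chat_le)
    obtain ⟨o, N, hrun⟩ := hI.exists_run (fun _ => hP.φstar_le_val hc.chat_le) hz0
    rcases le_or_gt ‖P.A ((P.aipp σ ρ c).zg o.z) - P.b‖ η with hfeas | hfail
    · exact ⟨_, _, .last c o N hrun hfeas⟩
    · have hcT := hP.le_T_of_infeasible hI hη hc.chat_le hz0 hrun hfail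
      obtain ⟨out, N', hrest⟩ := ih (hP.isPenalty_two_mul hc hcT)
        (by rwa [P.condNumber_two_mul, ← mul_assoc, ← pow_succ])
      exact ⟨out, N + N', .next c o N out N' hrun hfail hrest⟩

theorem runFrom_isApproxSolution (hP : P.Assumptions) (hσ0 : 0 < σ) (hσ1 : σ < 1) (hρ : 0 < ρ)
    (hz0 : z0 ∈ effDom P.h) (hc : 0 ≤ c) {out : Output n l} {N : ℕ}
    (hrun : P.RunFrom σ ρ η z0 c out N) : P.IsApproxSolution ρ η out := by
  induction hrun with
  | last c o N hrun hfeas =>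
    exact hP.isApproxSolution_of_aipp_run (hP.aipp_regular hσ0 hσ1 hρ hc) hc hz0 hrun hfeas
  | next c _ _ _ _ _ _ _ ih => exact ih (mul_nonneg zero_le_two hc)

/- The square roots of the condition numbers form a geometric progression, and `4 ≤ 3 √2` makes
the potential `4 √(2 Θ) - 3 √(condNumber c)` absorb the cost of each call. -/
theorem runFrom_iterations_le (hP : P.Assumptions) (hσ0 : 0 < σ) (hσ1 : σ < 1) (hρ : 0 < ρ)
    (hη : 0 < η) (hz0 : z0 ∈ effDom P.h) (hc : P.IsPenalty σ z0 η c) {out : Output n l} {N : ℕ}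
    (hrun : P.RunFrom σ ρ η z0 c out N) :
    (N : ℝ) ≤ callConst σ * P.bracket σ ρ η z0
      * (4 * √(2 * P.Θ σ z0 η) - 3 * √(P.condNumber c)) := by
  have hG : 0 ≤ callConst σ * P.bracket σ ρ η z0 :=
    mul_nonneg (callConst_pos hσ0 hσ1).le (zero_le_one.trans (hP.one_le_bracket hσ1 ρ η z0))
  induction hrun with
  | last c _ _ hrun _ =>
    refine (hP.aipp_run_iterations_le hσ0 hσ1 hρ hz0 hc hrun).trans
      (mul_le_mul_of_nonneg_left ?_ hG)
    linarith only [Real.sqrt_le_sqrt hc.condNumber_le]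
  | next c _ N _ N' hrun hfail _ ih =>
    have hI := hP.aipp_regular hσ0 hσ1 hρ (hP.chat_nonneg.trans hc.chat_le)
    have hcT := hP.le_T_of_infeasible hI hη hc.chat_le hz0 hrun hfail
    have hN := hP.aipp_run_iterations_le hσ0 hσ1 hρ hz0 hc hrun
    have hN' := ih (hP.isPenalty_two_mul hc hcT)
    have hgrowth : 4 / 3 * √(P.condNumber c) ≤ √(P.condNumber (2 * c)) := by
      rw [P.condNumber_two_mul, Real.sqrt_mul zero_le_two]
      gcongr
      exact Real.le_sqrt_of_sq_le (by norm_num)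
    push_cast
    linarith only [hN, hN', mul_le_mul_of_nonneg_left hgrowth hG]

theorem run_isApproxSolution (hP : P.Assumptions) (hσ0 : 0 < σ) (hσ1 : σ < 1) (hρ : 0 < ρ)
    (hz0 : z0 ∈ effDom P.h) {out : Output n l} {N : ℕ} (hrun : P.Run σ ρ η z0 out N) :
    P.IsApproxSolution ρ η out :=
  hP.runFrom_isApproxSolution hσ0 hσ1 hρ hz0
    (hP.chat_nonneg.trans (hP.isPenalty_initial hσ1 z0 η).chat_le) hrun

theorem run_iterations_le (hP : P.Assumptions) (hσ0 : 0 < σ) (hσ1 : σ < 1) (hρ : 0 < ρ)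
    (hη : 0 < η) (hz0 : z0 ∈ effDom P.h) {out : Output n l} {N : ℕ}
    (hrun : P.Run σ ρ η z0 out N) :
    (N : ℝ) ≤ 4 * √2 * callConst σ * (√(P.Θ σ z0 η) * P.bracket σ ρ η z0) := by
  have hG : 0 ≤ callConst σ * P.bracket σ ρ η z0 :=
    mul_nonneg (callConst_pos hσ0 hσ1).le (zero_le_one.trans (hP.one_le_bracket hσ1 ρ η z0))
  refine (hP.runFrom_iterations_le hσ0 hσ1 hρ hη hz0
    (hP.isPenalty_initial hσ1 z0 η) hrun).trans ?_
  rw [Real.sqrt_mul zero_le_two]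
  linarith only [mul_nonneg hG (Real.sqrt_nonneg (P.condNumber (P.chat + P.Lf / ‖P.A‖ ^ 2)))]

theorem exists_run (hP : P.Assumptions) (hσ0 : 0 < σ) (hσ1 : σ < 1) (hρ : 0 < ρ) (hη : 0 < η)
    (hz0 : z0 ∈ effDom P.h) : ∃ out N, P.Run σ ρ η z0 out N :=
  hP.exists_runFrom hσ0 hσ1 hρ hη hz0 (hP.isPenalty_initial hσ1 z0 η)

/-! ### The bound in terms of the tolerances -/

theorem Θ_le_div_sq (hP : P.Assumptions) (hσ1 : σ < 1) (z0 : Vec n) (hη : 0 < η) (hη1 : η ≤ 1) :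
    P.Θ σ z0 η ≤ P.Θ σ z0 1 / η ^ 2 := by
  have hm := hP.mf_pos
  have hlam := hP.lam_pos
  have hσ := sub_pos.2 hσ1
  have hfixed : 0 ≤ (P.Lf + P.chat * ‖P.A‖ ^ 2) / P.mf :=
    div_nonneg (add_nonneg hP.Lf_pos.le (mul_nonneg hP.chat_nonneg (sq_nonneg _))) hm.le
  have hΘ : ∀ η', P.Θ σ z0 η' = (P.Lf + P.chat * ‖P.A‖ ^ 2) / P.mf
      + 2 * P.R σ z0 P.chat P.lam / ((1 - σ) * P.lam) * ‖P.A‖ ^ 2 / P.mf / η' ^ 2 := fun η' => by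
    unfold Problem.Θ Problem.T
    field_simp
    ring
  rw [hΘ η, hΘ 1, one_pow, div_one]
  exact (add_le_add_left (le_div_self hfixed (by positivity) (pow_le_one₀ hη.le hη1)) _).trans_eq
    (add_div _ _ _).symm

theorem sqrt_Θ_le_div (hP : P.Assumptions) (hσ1 : σ < 1) (z0 : Vec n) (hη : 0 < η) (hη1 : η ≤ 1) :
    √(P.Θ σ z0 η) ≤ √(P.Θ σ z0 1) / η := by
  have hΘ := Real.sqrt_le_sqrt (hP.Θ_le_div_sq hσ1 z0 hη hη1)
  rwa [Real.sqrt_div' _ (sq_nonneg η), Real.sqrt_sq hη.le] at hΘ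

theorem logOnePlus_Θ_le (hP : P.Assumptions) (hσ1 : σ < 1) (z0 : Vec n) (hη : 0 < η)
    (hη1 : η ≤ 1) :
    logOnePlus (P.Θ σ z0 η) ≤ (Real.log (P.Θ σ z0 1) + 2) * logOnePlus (1 / η) := by
  have hΘ : 0 < P.Θ σ z0 1 := one_pos.trans_le (hP.one_le_Θ hσ1 z0 1)
  have hlogΘ := Real.log_nonneg (hP.one_le_Θ hσ1 z0 1)
  have hΛ := one_le_logOnePlus (1 / η)
  have hlogη : Real.log (1 / η) ≤ logOnePlus (1 / η) := le_max_left _ _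
  refine max_le ?_ (one_le_mul_of_one_le_of_one_le (by linarith only [hlogΘ]) hΛ)
  calc Real.log (P.Θ σ z0 η) ≤ Real.log (P.Θ σ z0 1 * (1 / η) ^ 2) :=
        Real.log_le_log (one_pos.trans_le (hP.one_le_Θ hσ1 z0 η))
          ((hP.Θ_le_div_sq hσ1 z0 hη hη1).trans_eq (by rw [one_div_pow, mul_one_div]))
    _ = Real.log (P.Θ σ z0 1) + 2 * Real.log (1 / η) := by
        rw [Real.log_mul hΘ.ne' (by positivity), Real.log_pow, Nat.cast_ofNat]
    _ ≤ Real.log (P.Θ σ z0 1) * logOnePlus (1 / η) + 2 * logOnePlus (1 / η) := by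
        gcongr
        exact le_mul_of_one_le_right hlogΘ hΛ
    _ = (Real.log (P.Θ σ z0 1) + 2) * logOnePlus (1 / η) := by ring

theorem bracket_le_mul_add (hP : P.Assumptions) (hσ1 : σ < 1) (ρ : ℝ) (z0 : Vec n) (hη : 0 < η)
    (hη1 : η ≤ 1) :
    P.bracket σ ρ η z0 ≤
      (P.mf ^ 2 * P.R σ z0 P.chat P.lam + (Real.log (P.Θ σ z0 1) + 2))
        * (1 / ρ ^ 2 + logOnePlus (1 / η)) := by
  have hR := mul_nonneg (sq_nonneg P.mf) (hP.R_nonneg hσ1 z0)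
  have hlogΘ := Real.log_nonneg (hP.one_le_Θ hσ1 z0 1)
  have hΛ := zero_le_one.trans (one_le_logOnePlus (1 / η))
  rw [bracket, div_eq_mul_one_div, add_mul]
  refine add_le_add ?_ ((hP.logOnePlus_Θ_le hσ1 z0 hη hη1).trans ?_)
  · gcongr
    exact le_add_of_nonneg_right hΛ
  · gcongr
    exact le_add_of_nonneg_left (by positivity)

theorem exists_iterations_le (hP : P.Assumptions) (hσ0 : 0 < σ) (hσ1 : σ < 1)
    (hz0 : z0 ∈ effDom P.h) :
    ∃ C : ℝ, 0 < C ∧ ∀ ρ η : ℝ, 0 < ρ → 0 < η → η ≤ 1 →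
      ∀ (out : Output n l) (N : ℕ), P.Run σ ρ η z0 out N →
        (N : ℝ) ≤ C * ((1 / ρ ^ 2 + logOnePlus (1 / η)) / η) := by
  have hΘ := one_pos.trans_le (hP.one_le_Θ hσ1 z0 1)
  have hlogΘ := Real.log_nonneg (hP.one_le_Θ hσ1 z0 1)
  have hR := hP.R_nonneg hσ1 z0
  have hconst := callConst_pos hσ0 hσ1
  set B := P.mf ^ 2 * P.R σ z0 P.chat P.lam + (Real.log (P.Θ σ z0 1) + 2)
  refine ⟨4 * √2 * callConst σ * (√(P.Θ σ z0 1) * B), by positivity,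
    fun ρ η hρ hη hη1 out N hrun => ?_⟩
  have hbracket := zero_le_one.trans (hP.one_le_bracket hσ1 ρ η z0)
  calc (N : ℝ) ≤ 4 * √2 * callConst σ * (√(P.Θ σ z0 η) * P.bracket σ ρ η z0) :=
        hP.run_iterations_le hσ0 hσ1 hρ hη hz0 hrun
    _ ≤ 4 * √2 * callConst σ
          * (√(P.Θ σ z0 1) / η * (B * (1 / ρ ^ 2 + logOnePlus (1 / η)))) := by
        gcongr
        · exact hP.sqrt_Θ_le_div hσ1 z0 hη hη1
        · exact hP.bracket_le_mul_add hσ1 ρ z0 hη hη1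
    _ = 4 * √2 * callConst σ * (√(P.Θ σ z0 1) * B)
          * ((1 / ρ ^ 2 + logOnePlus (1 / η)) / η) := by ring

end Assumptions

end Problem

theorem inv_sq_add_logOnePlus_le {K ρ η : ℝ} (hρ : 0 < ρ) (hρ1 : ρ ≤ 1)
    (hK : Real.log (1 / η) ≤ K / ρ ^ 2) :
    1 / ρ ^ 2 + logOnePlus (1 / η) ≤ (1 + max K 1) / ρ ^ 2 := by
  rw [add_div]
  refine add_le_add_right (max_le (hK.trans ?_) ?_) _
  · gcongr
    exact le_max_left _ _
  · rw [le_div_iff₀ (by positivity), one_mul]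
    exact (pow_le_one₀ hρ.le hρ1).trans (le_max_right _ _)

theorem Problem.Assumptions.exists_iterations_le_of_log_le {n l : ℕ} {P : Problem n l} {σ : ℝ}
    {z0 : Vec n} (hP : P.Assumptions) (hσ0 : 0 < σ) (hσ1 : σ < 1) (hz0 : z0 ∈ effDom P.h) (K : ℝ) :
    ∃ C : ℝ, 0 < C ∧ ∀ ρ η : ℝ, 0 < ρ → ρ ≤ 1 → 0 < η → η ≤ 1 →
      Real.log (1 / η) ≤ K / ρ ^ 2 →
      ∀ (out : Output n l) (N : ℕ), P.Run σ ρ η z0 out N → (N : ℝ) ≤ C * (1 / (ρ ^ 2 * η)) := by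
  obtain ⟨C, hC, hN⟩ := hP.exists_iterations_le hσ0 hσ1 hz0
  refine ⟨C * (1 + max K 1), by positivity, fun ρ η hρ hρ1 hη hη1 hK out N hrun => ?_⟩
  calc (N : ℝ) ≤ C * ((1 / ρ ^ 2 + logOnePlus (1 / η)) / η) := hN ρ η hρ hη hη1 out N hrun
    _ ≤ C * ((1 + max K 1) / ρ ^ 2 / η) := by
        gcongr
        exact inv_sq_add_logOnePlus_le hρ hρ1 hK
    _ = C * (1 + max K 1) * (1 / (ρ ^ 2 * η)) := by field_simp

end QPAIPP

theorem mainTheorem1_general (σ : ℝ) (hσ0 : 0 < σ) (hσ1 : σ < 1) :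
    (∃ C : ℝ, 0 < C ∧
      ∀ (n l : ℕ) (P : QPAIPP.Problem n l), P.Assumptions →
      ∀ z0 ∈ QPAIPP.effDom P.h, ∀ ρ η : ℝ, 0 < ρ → 0 < η →
        (∃ (out : QPAIPP.Output n l) (N : ℕ), P.Run σ ρ η z0 out N) ∧
        ∀ (out : QPAIPP.Output n l) (N : ℕ), P.Run σ ρ η z0 out N →
          P.IsApproxSolution ρ η out ∧
          (N : ℝ) ≤ C * (Real.sqrt (P.Θ σ z0 η) *
            (P.mf ^ 2 * P.R σ z0 P.chat P.lam / ρ ^ 2 + QPAIPP.logOnePlus (P.Θ σ z0 η)))) ∧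
    (∀ (n l : ℕ) (P : QPAIPP.Problem n l), P.Assumptions →
      ∀ z0 ∈ QPAIPP.effDom P.h,
        (∃ C : ℝ, 0 < C ∧ ∀ ρ η : ℝ, 0 < ρ → 0 < η → η ≤ 1 →
          ∀ (out : QPAIPP.Output n l) (N : ℕ), P.Run σ ρ η z0 out N →
            (N : ℝ) ≤ C * ((1 / ρ ^ 2 + QPAIPP.logOnePlus (1 / η)) / η)) ∧
        (∀ K : ℝ, ∃ C : ℝ, 0 < C ∧ ∀ ρ η : ℝ, 0 < ρ → ρ ≤ 1 → 0 < η → η ≤ 1 →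
          Real.log (1 / η) ≤ K / ρ ^ 2 →
          ∀ (out : QPAIPP.Output n l) (N : ℕ), P.Run σ ρ η z0 out N →
            (N : ℝ) ≤ C * (1 / (ρ ^ 2 * η)))) := by
  refine ⟨⟨4 * √2 * QPAIPP.Problem.callConst σ, ?_, fun n l P hP z0 hz0 ρ η hρ hη =>
      ⟨hP.exists_run hσ0 hσ1 hρ hη hz0, fun out N hrun => ?_⟩⟩,
    fun n l P hP z0 hz0 => ⟨?_, ?_⟩⟩
  · exact mul_pos (by positivity) (QPAIPP.Problem.callConst_pos hσ0 hσ1)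
  · exact ⟨hP.run_isApproxSolution hσ0 hσ1 hρ hz0 hrun,
      hP.run_iterations_le hσ0 hσ1 hρ hη hz0 hrun⟩
  · exact hP.exists_iterations_le hσ0 hσ1 hz0
  · exact hP.exists_iterations_le_of_log_le hσ0 hσ1 hz0

theorem mainTheorem1 (σ : ℝ) (hσ0 : 0 < σ) (hσ1 : σ < 1) :
    (∃ C : ℝ, 0 < C ∧
      ∀ (n l : ℕ) (P : QPAIPP.Problem n l), P.Assumptions →
      ∀ z0 ∈ QPAIPP.effDom P.h, ∀ ρ η : ℝ, 0 < ρ → 0 < η →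
        (∃ (out : QPAIPP.Output n l) (N : ℕ), P.Run σ ρ η z0 out N) ∧
        ∀ (out : QPAIPP.Output n l) (N : ℕ), P.Run σ ρ η z0 out N →
          P.IsApproxSolution ρ η out ∧
          (N : ℝ) ≤ C * (Real.sqrt (P.Θ σ z0 η) *
            (P.mf ^ 2 * P.R σ z0 P.chat P.lam / ρ ^ 2 + QPAIPP.logOnePlus (P.Θ σ z0 η)))) ∧
    (∀ (n l : ℕ) (P : QPAIPP.Problem n l), P.Assumptions →
      ∀ z0 ∈ QPAIPP.effDom P.h,
        (∃ C : ℝ, 0 < C ∧ ∀ ρ η : ℝ, 0 < ρ → ρ ≤ 1 → 0 < η → η ≤ 1 →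
          ∀ (out : QPAIPP.Output n l) (N : ℕ), P.Run σ ρ η z0 out N →
            (N : ℝ) ≤ C * ((1 / ρ ^ 2 + QPAIPP.logOnePlus (1 / η)) / η)) ∧
        (∀ K : ℝ, ∃ C : ℝ, 0 < C ∧ ∀ ρ η : ℝ, 0 < ρ → ρ ≤ 1 → 0 < η → η ≤ 1 →
          Real.log (1 / η) ≤ K / ρ ^ 2 →
          ∀ (out : QPAIPP.Output n l) (N : ℕ), P.Run σ ρ η z0 out N →
            (N : ℝ) ≤ C * (1 / (ρ ^ 2 * η)))) := by
  exact (mainTheorem1_general σ hσ0 hσ1).imp_right fun h n l P hP z0 hz0 =>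
    (h n l P hP z0 hz0).imp_left fun ⟨C, hC, hN⟩ => ⟨C, hC, fun ρ η hρ _ => hN ρ η hρ⟩
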